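/- Let $N$ be a lattice of rank $2$ and $N_{\mathbb R}=N\otimes_{\mathbb Z}\mathbb R$. We use the following notions. *Primitive generating sets.* For a linear subspace $M\subseteq N_{\mathbb R}$, a finite set $A$ of primitive points of $N$ is a primitive generating set of $M$ if $M=\{\sum_{v\in A}\lambda_v v : \lambda_v\ge 0\}$. A reduction $A\mathrel{\dot\supset}A'$ is an inclusion $A\supset A'$ of primitive generating sets of the same space with $|A|=|A'|+1$. A fiber structure $A_f\subset A$ on $A$ is a nonempty subset that is a primitive generating set of its linear span $L$ and satisfies $A_f=L\cap A$. Its base $A_b\subset N/(N\cap L)$ is the set of primitive generators of the rays spanned by the images of the points of $A\setminus A_f$. The fiber structure is irreducible if $|A|=|A_f|+|A_b|$. It is a Mori fiber structure, written $A_f\subset_m A$, if it is irreducible and $|A_f|=\dim L+1$. *Fano polytopes.* A Fano polytope in a linear subspace $M\subseteq N_{\mathbb R}$ is the convex hull of finitely many points of $N\cap M$ that contains the origin in its interior relative to $M$ and all of whose vertices are primitive points of $N$; a Fano polygon is a Fano polytope in $N_{\mathbb R}$. A reduction $\nabla\mathrel{\dot\supset}\nabla'$ (between Fano polytopes in the same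 subspace), a fiber structure $\nabla_f\subset\nabla$, and a Mori fiber structure $\nabla_f\subset_m\nabla$ of Fano polytopes (where $\nabla_f$ is a Fano polytope in its own linear span) mean that the sets of primitive lattice points contained in these polytopes form, respectively, a reduction, a fiber structure, a Mori fiber structure. A Fano polygon $\nabla$ is minimal if there is no reduction $\nabla\mathrel{\dot\supset}\nabla'$. A Mori fiber polygon is a Fano polygon $\nabla$ together with a Mori fiber structure $\nabla_f\subset_m\nabla$. *Elementary links consisting only of Fano polygons.* Two Mori fiber polygons $\nabla_f\subset_m\nabla$ and $\nabla_f'\subset_m\nabla'$ are related by such a link if, possibly after exchanging them, one of the following holds, where $\nabla''$ and $\nabla_f''$ denote Fano polytopes in $N_{\mathbb R}$ and in the linear span of $\nabla_f''$, respectively, with a fiber structure $\nabla_f''\subset\nabla''$: - ($\mathrm{I}_d$) $\nabla\mathrel{\dot\supset}\nabla'$ and $\nabla_f=\nabla_f'$; - ($\mathrm{I}_m$) $\nabla=\nabla''\mathrel{\dot\supset}\nabla'$ and $\nabla_f\subset_m\nabla_f''\mathrel{\dot\supset}\nabla_f'$; - ($\mathrm{II}_{irr}$) $\nabla\mathrel{\dot\subset}\nabla''\mathrel{\dot\supset}\nabla'$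 and $\nabla_f\mathrel{\dot\subset}\nabla_f''\mathrel{\dot\supset}\nabla_f'$; - ($\mathrm{II}_{ni}$) $\nabla\mathrel{\dot\subset}\nabla''\mathrel{\dot\supset}\nabla'$ and $\nabla_f=\nabla_f''=\nabla_f'$; - ($\mathrm{IV}_m$) $\nabla=\nabla''=\nabla'$ and $\nabla_f\subset_m\nabla_f''\mathrel{\supset_m}\nabla_f'$; - ($\mathrm{IV}_s$) $\nabla=\nabla'$ and $\nabla_f=\nabla_f'$. **Proposition 3.5.** (1) Every minimal Fano polygon $\nabla$ in $N_{\mathbb R}$ admits a Mori fiber structure $\nabla_f\subset_m\nabla$. (2) Any two Mori fiber polygons $\nabla_f\subset_m\nabla$ and $\nabla_f'\subset_m\nabla'$ in $N_{\mathbb R}$ are connected by a finite sequence of elementary links consisting only of Fano polygons. -/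

import Mathlib

open scoped Topology

namespace FanoLinks

section

variable {V : Type*} [AddCommGroup V] [Module ℝ V]

/-- `v` is a primitive point of the lattice `N`: a nonzero lattice point that is not a proper
multiple of another lattice point. For `v` in a linear subspace `L`, being primitive in `N`
and being primitive in `N ∩ L` are the same. -/
def IsPrimitive (N : Submodule ℤ V) (v : V) : Prop :=
  v ∈ N ∧ v ≠ 0 ∧ ∀ w ∈ N, ∀ k : ℕ, v = k • w → k = 1

/-- `A` is a primitive generating set of the linear subspace `L`: a finite set of primitive
lattice points whose nonnegative real combinations are exactly the points of `L`. -/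
structure IsPrimGenSet (N : Submodule ℤ V) (L : Submodule ℝ V) (A : Set V) : Prop where
  finite : A.Finite
  primitive : ∀ v ∈ A, IsPrimitive N v
  generates : (PointedCone.hull ℝ A : Set V) = (L : Set V)

/-- `A ⊃ A'` is a reduction of primitive generating sets of `L`. -/
structure IsReduction (N : Submodule ℤ V) (L : Submodule ℝ V) (A A' : Set V) : Prop where
  left : IsPrimGenSet N L A
  right : IsPrimGenSet N L A'
  subset : A' ⊆ A
  card : A.ncard = A'.ncard + 1

/-- `Af ⊂ A` is a fiber structure on the primitive generating set `A` of `M`. -/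
structure IsFiberStructure (N : Submodule ℤ V) (M : Submodule ℝ V) (A Af : Set V) : Prop where
  total : IsPrimGenSet N M A
  nonempty : Af.Nonempty
  fiber : IsPrimGenSet N (Submodule.span ℝ Af) Af
  eq_inter : Af = (Submodule.span ℝ Af : Set V) ∩ A

/-- The lattice `N / (N ∩ L)`, realized as the image of `N` in `V ⧸ L`. -/
def quotientLattice (N : Submodule ℤ V) (L : Submodule ℝ V) : Submodule ℤ (V ⧸ L) :=
  N.map (L.mkQ.restrictScalars ℤ)

/-- The base of a fiber structure `Af ⊂ A`: the primitive generators, in the quotient lattice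
by the linear span of `Af`, of the rays spanned by the images of the points of `A \ Af`. -/
def base (N : Submodule ℤ V) (A Af : Set V) : Set (V ⧸ Submodule.span ℝ Af) :=
  {w | IsPrimitive (quotientLattice N (Submodule.span ℝ Af)) w ∧
    ∃ v ∈ A \ Af, ∃ c : ℝ, 0 < c ∧ w = c • (Submodule.span ℝ Af).mkQ v}

/-- `Af ⊂ A` is a Mori fiber structure on the primitive generating set `A` of `M`:
an irreducible fiber structure (field `irreducible`) with `|Af| = dim L + 1`, where `L` is the
linear span of `Af`. -/
structure IsMoriFiberStructure (N : Submodule ℤ V) (M : Submodule ℝ V) (A Af : Set V) : Prop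
    extends IsFiberStructure N M A Af where
  irreducible : A.ncard = Af.ncard + (base N A Af).ncard
  card : Af.ncard = Module.finrank ℝ (Submodule.span ℝ Af) + 1

/-- The primitive lattice points contained in `P`. -/
def primPoints (N : Submodule ℤ V) (P : Set V) : Set V :=
  {v | v ∈ P ∧ IsPrimitive N v}

end

section

variable {V : Type*} [NormedAddCommGroup V] [NormedSpace ℝ V]

/-- `P` is a Fano polytope in the linear subspace `L`, with respect to the lattice `N ∩ L`:
a lattice polytope in `L` that contains the origin as an interior point (relative to `L`)
and whose vertices are primitive. -/
structure IsFanoPolytope (N : Submodule ℤ V) (L : Submodule ℝ V) (P : Set V) : Prop where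
  lattice : ∃ S : Set V, S.Finite ∧ S ⊆ N ∧ P = convexHull ℝ S
  subset : P ⊆ L
  zero_interior : P ∈ 𝓝[(L : Set V)] (0 : V)
  vertices : ∀ v ∈ P.extremePoints ℝ, IsPrimitive N v

/-- `P ⊃ P'` is a reduction of Fano polytopes in `L`. -/
structure IsFanoReduction (N : Submodule ℤ V) (L : Submodule ℝ V) (P P' : Set V) : Prop where
  left : IsFanoPolytope N L P
  right : IsFanoPolytope N L P'
  reduction : IsReduction N L (primPoints N P) (primPoints N P')

/-- `P` is a minimal Fano polytope in `L`: it has no reduction. -/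
structure IsMinimalFano (N : Submodule ℤ V) (L : Submodule ℝ V) (P : Set V) : Prop where
  fano : IsFanoPolytope N L P
  minimal : ¬ ∃ P' : Set V, IsFanoReduction N L P P'

/-- `F ⊂ P` is a fiber structure of Fano polytopes, `P` being a Fano polytope in `M` and `F`
a Fano polytope in its linear span. -/
structure IsFanoFiberStructure (N : Submodule ℤ V) (M : Submodule ℝ V) (P F : Set V) :
    Prop where
  total : IsFanoPolytope N M P
  fiber : IsFanoPolytope N (Submodule.span ℝ F) F
  fiberStructure : IsFiberStructure N M (primPoints N P) (primPoints N F)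

/-- `F ⊂ P` is a Mori fiber structure of Fano polytopes, `P` being a Fano polytope in `M` and
`F` a Fano polytope in its linear span. -/
structure IsFanoMoriFiberStructure (N : Submodule ℤ V) (M : Submodule ℝ V) (P F : Set V) :
    Prop where
  total : IsFanoPolytope N M P
  fiber : IsFanoPolytope N (Submodule.span ℝ F) F
  moriFiberStructure : IsMoriFiberStructure N M (primPoints N P) (primPoints N F)

/-- A Mori fiber polytope in the whole space: a Fano polytope together with a Mori fiber
structure on it. -/
structure MoriFiberPolytope (N : Submodule ℤ V) where
  total : Set V
  fiber : Set V
  isMori : IsFanoMoriFiberStructure N ⊤ total fiber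

/-- The diagrams of elementary links between the Mori fiber polytopes `X` and `Y`, in which
every member is a Fano polytope. The middle column of a diagram, where it is not determined
by the outer ones, consists of a Fano polytope `P` with a fiber structure `F ⊂ P`. -/
inductive IsLinkDiagram (N : Submodule ℤ V) (X Y : MoriFiberPolytope N) : Prop
  | typeId
      (total : IsFanoReduction N ⊤ X.total Y.total)
      (fiber : X.fiber = Y.fiber)
  | typeIm (F : Set V)
      (middle : IsFanoFiberStructure N ⊤ X.total F)
      (total : IsFanoReduction N ⊤ X.total Y.total)
      (fiber_left : IsFanoMoriFiberStructure N (Submodule.span ℝ F) F X.fiber)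
      (fiber_right : IsFanoReduction N (Submodule.span ℝ F) F Y.fiber)
  | typeIIirr (P F : Set V)
      (middle : IsFanoFiberStructure N ⊤ P F)
      (total_left : IsFanoReduction N ⊤ P X.total)
      (total_right : IsFanoReduction N ⊤ P Y.total)
      (fiber_left : IsFanoReduction N (Submodule.span ℝ F) F X.fiber)
      (fiber_right : IsFanoReduction N (Submodule.span ℝ F) F Y.fiber)
  | typeIIni (P F : Set V)
      (middle : IsFanoFiberStructure N ⊤ P F)
      (total_left : IsFanoReduction N ⊤ P X.total)
      (total_right : IsFanoReduction N ⊤ P Y.total)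
      (fiber_left : X.fiber = F)
      (fiber_right : Y.fiber = F)
  | typeIVm (F : Set V)
      (middle : IsFanoFiberStructure N ⊤ X.total F)
      (total : X.total = Y.total)
      (fiber_left : IsFanoMoriFiberStructure N (Submodule.span ℝ F) F X.fiber)
      (fiber_right : IsFanoMoriFiberStructure N (Submodule.span ℝ F) F Y.fiber)
  | typeIVs
      (total : X.total = Y.total)
      (fiber : X.fiber = Y.fiber)

/-- `X` and `Y` are related by an elementary link consisting only of Fano polytopes: one of
the diagrams above or the inverse of one. -/
def IsElementaryLink (N : Submodule ℤ V) (X Y : MoriFiberPolytope N) : Prop :=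
  IsLinkDiagram N X Y ∨ IsLinkDiagram N Y X

end

end FanoLinks

namespace FanoLinks

/-! Everything is done in terms of the finite set of primitive points, which determines a Fano
polygon as its convex hull.

For the existence of a Mori fiber structure, write the origin as a positive combination of affinely
independent vertices. Two vertices must be opposite primitive points; otherwise there are three
(`exists_pair_or_triple`). Minimality says that deleting a vertex pushes the origin out of the
interior. If `±f` are primitive points of the polygon, this leaves one primitive point on each side
of the line through `f`, and these lie at heights `±1`; so the segment from `-f` to `f` is a Mori
fiber. Without opposite points, a further primitive point could replace one of the three vertices,
so there are exactly three primitive points (`minimal_cases`) and the polygon is its own Mori fiber.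

For the links, counting points in the definition of a Mori fiber structure leaves two families
(`classification`): the polygons `ruled a c`, which belong to Hirzebruch surfaces, and the polygon
of the projective plane, whose points are `u, v, -u - v` for a lattice basis (`exists_eq_triangle`).
Three kinds of links suffice. Type II_ni moves a section by one step along the fiber
(`linked_add_one`), so every ruled polygon is linked to the product polygon `ruled 0 0` of its
basis, and shearing the basis does not matter. Type IV_m exchanges the two rulings of a product
(`linked_swap`). Type I_m is the blow-up of the plane (`linked_triangle`). Shears, swaps and signs
connect any two lattice bases by the Euclidean algorithm (`linked_basis`), so everything is linked
to one fixed product polygon. -/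

theorem IsPrimitive.neg {V : Type*} [AddCommGroup V] {N : Submodule ℤ V} {v : V}
    (h : IsPrimitive N v) : IsPrimitive N (-v) :=
  ⟨N.neg_mem h.1, neg_ne_zero.2 h.2.1, fun w hw k e =>
    h.2.2 (-w) (N.neg_mem hw) k (by rw [smul_neg, ← e, neg_neg])⟩

/-! ### Lattice bases and primitive vectors in the plane. -/

section LatticeBasis

variable {V : Type*} [AddCommGroup V] [Module ℝ V] {N : Submodule ℤ V} {f g u v : V}

/-- `f, g` form a basis of the real vector space `V` and a `ℤ`-basis of the lattice `N`. -/
structure IsLatticeBasis (N : Submodule ℤ V) (f g : V) : Prop where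
  left_mem : f ∈ N
  right_mem : g ∈ N
  exists_eq : ∀ v, ∃ x y : ℝ, v = x • f + y • g
  eq_zero : ∀ x y : ℝ, x • f + y • g = 0 → x = 0 ∧ y = 0
  exists_int : ∀ v ∈ N, ∃ m n : ℤ, v = (m : ℝ) • f + (n : ℝ) • g

theorem int_smul_mem (hv : v ∈ N) (m : ℤ) : (m : ℝ) • v ∈ N := by
  rw [Int.cast_smul_eq_zsmul]
  exact N.smul_mem m hv

theorem int_combination_mem (hf : f ∈ N) (hg : g ∈ N) (m n : ℤ) :
    (m : ℝ) • f + (n : ℝ) • g ∈ N :=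
  N.add_mem (int_smul_mem hf m) (int_smul_mem hg n)

namespace IsLatticeBasis

theorem swap (h : IsLatticeBasis N f g) : IsLatticeBasis N g f where
  left_mem := h.right_mem
  right_mem := h.left_mem
  exists_eq v := by
    obtain ⟨x, y, e⟩ := h.exists_eq v
    exact ⟨y, x, by rw [e, add_comm]⟩
  eq_zero x y e := (h.eq_zero y x (by rw [add_comm, e])).symm
  exists_int v hv := by
    obtain ⟨m, n, e⟩ := h.exists_int v hv
    exact ⟨n, m, by rw [e, add_comm]⟩

theorem neg_right (h : IsLatticeBasis N f g) : IsLatticeBasis N f (-g) where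
  left_mem := h.left_mem
  right_mem := N.neg_mem h.right_mem
  exists_eq v := by
    obtain ⟨x, y, e⟩ := h.exists_eq v
    exact ⟨x, -y, by rw [e]; simp⟩
  eq_zero x y e := by
    have := h.eq_zero x (-y) (by rw [← e]; simp)
    exact ⟨this.1, by linarith [this.2]⟩
  exists_int v hv := by
    obtain ⟨m, n, e⟩ := h.exists_int v hv
    exact ⟨m, -n, by rw [e]; simp⟩

theorem neg_left (h : IsLatticeBasis N f g) : IsLatticeBasis N (-f) g :=
  h.swap.neg_right.swap

theorem shear (h : IsLatticeBasis N f g) (k : ℤ) : IsLatticeBasis N f ((k : ℝ) • f + g) where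
  left_mem := h.left_mem
  right_mem := N.add_mem (int_smul_mem h.left_mem k) h.right_mem
  exists_eq v := by
    obtain ⟨x, y, e⟩ := h.exists_eq v
    exact ⟨x - y * k, y, by rw [e]; module⟩
  eq_zero x y e := by
    have := h.eq_zero (x + y * k) y (by rw [← e]; module)
    refine ⟨?_, this.2⟩
    have h1 := this.1
    rw [this.2] at h1
    simpa using h1
  exists_int v hv := by
    obtain ⟨m, n, e⟩ := h.exists_int v hv
    exact ⟨m - n * k, n, by rw [e]; push_cast; module⟩

theorem inj (h : IsLatticeBasis N f g) {x y x' y' : ℝ}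
    (e : x • f + y • g = x' • f + y' • g) : x = x' ∧ y = y' := by
  have := h.eq_zero (x - x') (y - y') (by
    rw [← sub_eq_zero] at e
    rw [← e]; module)
  exact ⟨by linarith [this.1], by linarith [this.2]⟩

theorem linearIndependent (h : IsLatticeBasis N f g) : LinearIndependent ℝ ![f, g] :=
  LinearIndependent.pair_iff.2 h.eq_zero

theorem span_eq_top (h : IsLatticeBasis N f g) : Submodule.span ℝ {f, g} = ⊤ := by
  rw [eq_top_iff]
  intro v _
  obtain ⟨x, y, e⟩ := h.exists_eq v
  exact Submodule.mem_span_pair.2 ⟨x, y, e.symm⟩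

/-- The coordinate functionals of a lattice basis. -/
theorem exists_coord (h : IsLatticeBasis N f g) : ∃ x y : V →ₗ[ℝ] ℝ,
    (∀ v, v = x v • f + y v • g) ∧ x f = 1 ∧ x g = 0 ∧ y f = 0 ∧ y g = 1 := by
  let b : Module.Basis (Fin 2) ℝ V := Module.Basis.mk h.linearIndependent
    (by rw [Matrix.range_cons_cons_empty]; exact h.span_eq_top.ge)
  have b0 : b 0 = f := by simp [b]
  have b1 : b 1 = g := by simp [b]
  refine ⟨b.coord 0, b.coord 1, fun v => ?_, ?_, ?_, ?_, ?_⟩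
  · have := b.sum_repr v
    rw [Fin.sum_univ_two, b0, b1] at this
    exact this.symm
  all_goals first | rw [← b0] | rw [← b1]
  all_goals simp [Module.Basis.coord_apply]

theorem left_ne_zero (h : IsLatticeBasis N f g) : f ≠ 0 := by
  intro e
  have := h.eq_zero 1 0 (by simp [e])
  exact one_ne_zero this.1

theorem isPrimitive_right (h : IsLatticeBasis N f g) : IsPrimitive N g := by
  refine ⟨h.right_mem, h.swap.left_ne_zero, fun w hw k e => ?_⟩
  obtain ⟨m, n, rfl⟩ := h.exists_int w hw
  have := h.inj (x := 0) (y := 1) (x' := k * m) (y' := k * n) (by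
    rw [zero_smul, one_smul, zero_add]
    conv_lhs => rw [e]
    rw [← Nat.cast_smul_eq_nsmul ℝ]; module)
  have h2 : (k : ℤ) * n = 1 := by exact_mod_cast this.2.symm
  have := Int.isUnit_iff.1 (IsUnit.of_mul_eq_one _ h2)
  omega

theorem isPrimitive_left (h : IsLatticeBasis N f g) : IsPrimitive N f :=
  h.swap.isPrimitive_right

theorem isPrimitive_add (h : IsLatticeBasis N f g) (k : ℤ) :
    IsPrimitive N ((k : ℝ) • f + g) :=
  (h.shear k).isPrimitive_right

end IsLatticeBasis

theorem IsPrimitive.natAbs_eq_one (h : IsPrimitive N v) (hu : u ∈ N) {m : ℤ}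
    (e : v = (m : ℝ) • u) : m = 1 ∨ m = -1 := by
  rw [Int.cast_smul_eq_zsmul] at e
  have : m.natAbs = 1 := by
    rcases Int.natAbs_eq m with hm | hm
    · refine h.2.2 u hu _ ?_
      rw [e, ← natCast_zsmul, ← hm]
    · refine h.2.2 (-u) (N.neg_mem hu) _ ?_
      rw [e, ← natCast_zsmul, smul_neg, ← neg_smul, ← hm]
  omega

theorem IsLatticeBasis.isCoprime (h : IsLatticeBasis N f g) {m n : ℤ}
    (hp : IsPrimitive N ((m : ℝ) • f + (n : ℝ) • g)) : IsCoprime m n := by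
  rw [Int.isCoprime_iff_gcd_eq_one]
  obtain ⟨a, ha⟩ := Int.gcd_dvd_left m n
  obtain ⟨b, hb⟩ := Int.gcd_dvd_right m n
  refine hp.2.2 ((a : ℝ) • f + (b : ℝ) • g) (int_combination_mem h.left_mem h.right_mem _ _) _ ?_
  rw [← Nat.cast_smul_eq_nsmul ℝ]
  have ha' : (m : ℝ) = (Int.gcd m n : ℝ) * a := by exact_mod_cast ha
  have hb' : (n : ℝ) = (Int.gcd m n : ℝ) * b := by exact_mod_cast hb
  conv_lhs => rw [ha', hb']
  module

/-- A primitive vector extends to a lattice basis. -/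
theorem IsLatticeBasis.exists_basis (h : IsLatticeBasis N f g) (hv : IsPrimitive N v) :
    ∃ w, IsLatticeBasis N v w := by
  obtain ⟨m, n, rfl⟩ := h.exists_int v hv.1
  obtain ⟨s, t, hst⟩ := h.isCoprime hv
  have hst' : (s : ℝ) * m + t * n = 1 := by exact_mod_cast hst
  -- The Bézout coefficients give a second vector `-t f + s g` for which the change of basis has
  -- determinant `s m + t n = 1`; `key` is the inverse change of coordinates, which is again
  -- integral.
  have key : ∀ x y : ℝ, x • f + y • g = (s * x + t * y) • ((m : ℝ) • f + (n : ℝ) • g) +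
      (m * y - n * x) • ((-t : ℝ) • f + (s : ℝ) • g) := by
    intro x y
    have e1 : x = (s * x + t * y) * m + (m * y - n * x) * (-t) := by linear_combination (-x) * hst'
    have e2 : y = (s * x + t * y) * n + (m * y - n * x) * s := by linear_combination (-y) * hst'
    conv_lhs => rw [e1, e2]
    module
  refine ⟨(-t : ℝ) • f + (s : ℝ) • g, hv.1, ?_, ?_, ?_, ?_⟩
  · have := int_combination_mem h.left_mem h.right_mem (-t) s
    push_cast at this
    exact this
  · intro v
    obtain ⟨x, y, rfl⟩ := h.exists_eq v
    exact ⟨_, _, key x y⟩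
  · intro x y e
    have := h.eq_zero (x * m + y * (-t)) (x * n + y * s) (by rw [← e]; module)
    constructor
    · linear_combination s * this.1 + t * this.2 - x * hst'
    · linear_combination m * this.2 - n * this.1 - y * hst'
  · intro v hv
    obtain ⟨x, y, rfl⟩ := h.exists_int v hv
    exact ⟨s * x + t * y, m * y - n * x, by push_cast; exact key x y⟩

/-- Parallel primitive vectors agree up to sign. -/
theorem IsLatticeBasis.eq_or_eq_neg (h : IsLatticeBasis N f g) (hf : IsPrimitive N u)
    {c : ℝ} (e : u = c • f) : (c = 1 ∧ u = f) ∨ (c = -1 ∧ u = -f) := by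
  obtain ⟨m, n, e'⟩ := h.exists_int u hf.1
  have := h.inj (x := c) (y := 0) (x' := m) (y' := n) (by rw [← e', e]; simp)
  rw [this.1] at e ⊢
  rcases hf.natAbs_eq_one h.left_mem e with rfl | rfl
  · left; simpa using e
  · right; simpa using e

theorem IsLatticeBasis.parallel (h : IsLatticeBasis N f g) (hu : IsPrimitive N u)
    (hv : IsPrimitive N v) {c : ℝ} (e : u = c • v) : (c = 1 ∧ u = v) ∨ (c = -1 ∧ u = -v) := by
  obtain ⟨w, hw⟩ := h.exists_basis hv
  exact hw.eq_or_eq_neg hu e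

end LatticeBasis

theorem exists_isLatticeBasis {V : Type*} [NormedAddCommGroup V] [NormedSpace ℝ V]
    (N : Submodule ℤ V) [DiscreteTopology N] [IsZLattice ℝ N]
    (hdim : Module.finrank ℝ V = 2) : ∃ f g : V, IsLatticeBasis N f g := by
  have : FiniteDimensional ℝ V := Module.finite_of_finrank_pos (by omega)
  have := ZLattice.module_finite ℝ N
  have := ZLattice.module_free ℝ N
  have hr : Module.finrank ℤ N = 2 := by rw [ZLattice.rank ℝ N, hdim]
  let b : Module.Basis (Fin 2) ℤ N := Module.finBasisOfFinrankEq ℤ N hr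
  let B := b.ofZLatticeBasis ℝ N
  have hB : ∀ i, B i = b i := fun i => b.ofZLatticeBasis_apply ℝ N i
  refine ⟨b 0, b 1, (b 0).2, (b 1).2, fun v => ?_, fun x y e => ?_, fun v hv => ?_⟩
  · refine ⟨B.repr v 0, B.repr v 1, ?_⟩
    rw [← hB, ← hB]
    conv_lhs => rw [← B.sum_repr v, Fin.sum_univ_two]
  · have hl : ![B 0, B 1] = B := by ext i; fin_cases i <;> rfl
    have := LinearIndependent.pair_iff.1 (hl ▸ B.linearIndependent)
    exact this x y (by rw [hB, hB, e])
  · refine ⟨b.repr ⟨v, hv⟩ 0, b.repr ⟨v, hv⟩ 1, ?_⟩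
    have := congrArg Subtype.val (b.sum_repr ⟨v, hv⟩)
    rw [Fin.sum_univ_two] at this
    rw [Int.cast_smul_eq_zsmul, Int.cast_smul_eq_zsmul]
    simpa using this.symm

/-! ### Fano polytopes, their primitive points, and criteria for an interior origin. -/

section Polytope

variable {V : Type*} [NormedAddCommGroup V] [NormedSpace ℝ V] {N : Submodule ℤ V}
  {L : Submodule ℝ V} {P P' F B : Set V} {f g u v : V}

theorem IsFanoPolytope.convex (h : IsFanoPolytope N L P) : Convex ℝ P := by
  obtain ⟨S, _, _, rfl⟩ := h.lattice
  exact convex_convexHull ℝ S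

theorem IsFanoPolytope.isCompact (h : IsFanoPolytope N L P) : IsCompact P := by
  obtain ⟨S, hS, _, rfl⟩ := h.lattice
  exact hS.isCompact_convexHull ℝ

theorem IsFanoPolytope.zero_mem (h : IsFanoPolytope N L P) : (0 : V) ∈ P :=
  mem_of_mem_nhdsWithin L.zero_mem h.zero_interior

theorem IsFanoPolytope.extremePoints_subset (h : IsFanoPolytope N L P) :
    P.extremePoints ℝ ⊆ primPoints N P :=
  fun v hv => ⟨_root_.extremePoints_subset hv, h.vertices v hv⟩

theorem IsFanoPolytope.convexHull_extremePoints (h : IsFanoPolytope N L P) :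
    convexHull ℝ (P.extremePoints ℝ) = P := by
  obtain ⟨S, hS, _, rfl⟩ := h.lattice
  have hE : ((convexHull ℝ S).extremePoints ℝ).Finite := hS.subset extremePoints_convexHull_subset
  have := closure_convexHull_extremePoints (hS.isCompact_convexHull ℝ) (convex_convexHull ℝ S)
  rwa [(hE.isClosed_convexHull ℝ).closure_eq] at this

/-- All vertices are primitive points, so no information is lost in passing from a polytope to its
primitive points. -/
theorem IsFanoPolytope.convexHull_primPoints (h : IsFanoPolytope N L P) :
    convexHull ℝ (primPoints N P) = P := by
  apply Set.Subset.antisymm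
  · exact convexHull_min (fun v hv => hv.1) h.convex
  · conv_lhs => rw [← h.convexHull_extremePoints]
    exact convexHull_mono h.extremePoints_subset

theorem IsFanoPolytope.eq_of_primPoints {L' : Submodule ℝ V} (h : IsFanoPolytope N L P)
    (h' : IsFanoPolytope N L' P') (e : primPoints N P = primPoints N P') : P = P' := by
  rw [← h.convexHull_primPoints, ← h'.convexHull_primPoints, e]

theorem IsFanoPolytope.finite_primPoints [FiniteDimensional ℝ V] [DiscreteTopology N]
    (h : IsFanoPolytope N L P) : (primPoints N P).Finite := by
  have hN : IsClosed (N : Set V) :=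
    inferInstanceAs (IsClosed (N.toAddSubgroup : Set V))
  have : (P ∩ N).Finite := Metric.finite_isBounded_inter_isClosed
    (s := (N : Set V)) DiscreteTopology.isDiscrete h.isCompact.isBounded hN
  exact this.subset fun v hv => ⟨hv.1, hv.2.1⟩

theorem exists_smul_mem_of_mem_nhdsWithin (h : P ∈ 𝓝[(L : Set V)] (0 : V)) (hv : v ∈ L) :
    ∃ c : ℝ, 0 < c ∧ c • v ∈ P := by
  have h1 : Filter.Tendsto (fun c : ℝ => c • v) (𝓝[>] 0) (𝓝[(L : Set V)] (0 : V)) := by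
    apply tendsto_nhdsWithin_of_tendsto_nhds_of_eventually_within
    · have : Filter.Tendsto (fun c : ℝ => c • v) (𝓝 0) (𝓝 ((0 : ℝ) • v)) :=
        (continuous_id.smul continuous_const).tendsto 0
      rw [zero_smul] at this
      exact this.mono_left nhdsWithin_le_nhds
    · exact Filter.Eventually.of_forall fun c => L.smul_mem c hv
  have h2 := (h1.eventually h).and (self_mem_nhdsWithin (a := (0 : ℝ)) (s := Set.Ioi 0))
  obtain ⟨c, hc, hc'⟩ := h2.exists
  exact ⟨c, hc', hc⟩

/-- A small positive multiple of each vector of `L` lies in the neighborhood, and cones are closed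
under scaling back. -/
theorem hull_eq_of_mem_nhdsWithin (hB : B ⊆ L)
    (h : convexHull ℝ B ∈ 𝓝[(L : Set V)] (0 : V)) :
    (PointedCone.hull ℝ B : Set V) = L := by
  apply Set.Subset.antisymm
  · intro x hx
    have := PointedCone.hull_le_span (R := ℝ) B hx
    exact Submodule.span_le.2 hB this
  · intro x hx
    obtain ⟨c, hc, hcx⟩ := exists_smul_mem_of_mem_nhdsWithin h hx
    have h1 : c • x ∈ (PointedCone.hull ℝ B : Set V) :=
      convexHull_min PointedCone.subset_hull (PointedCone.convex _) hcx
    have h2 : x = (⟨c⁻¹, by positivity⟩ : {r : ℝ // 0 ≤ r}) • (c • x) := by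
      change x = c⁻¹ • c • x
      rw [smul_smul, inv_mul_cancel₀ hc.ne', one_smul]
    rw [h2]
    exact Submodule.smul_mem _ _ h1

theorem IsFanoPolytope.isPrimGenSet [FiniteDimensional ℝ V] [DiscreteTopology N]
    (h : IsFanoPolytope N L P) : IsPrimGenSet N L (primPoints N P) where
  finite := h.finite_primPoints
  primitive v hv := hv.2
  generates := hull_eq_of_mem_nhdsWithin (fun v hv => h.subset hv.1)
    (by rw [h.convexHull_primPoints]; exact h.zero_interior)

theorem IsPrimGenSet.span_eq (h : IsPrimGenSet N L B) : Submodule.span ℝ B = L := by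
  apply le_antisymm
  · rw [Submodule.span_le, ← h.generates]
    exact PointedCone.subset_hull
  · intro x hx
    have : x ∈ (PointedCone.hull ℝ B : Set V) := by rw [h.generates]; exact hx
    exact PointedCone.hull_le_span (R := ℝ) B this

theorem IsFanoPolytope.span_primPoints [FiniteDimensional ℝ V] [DiscreteTopology N]
    (h : IsFanoPolytope N L P) : Submodule.span ℝ (primPoints N P) = L :=
  h.isPrimGenSet.span_eq

theorem IsFanoPolytope.span_eq [FiniteDimensional ℝ V] [DiscreteTopology N]
    (h : IsFanoPolytope N L P) : Submodule.span ℝ P = L := by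
  apply le_antisymm
  · exact Submodule.span_le.2 h.subset
  · rw [← h.span_primPoints]
    exact Submodule.span_mono fun v hv => hv.1

theorem isFanoPolytope_convexHull (hfin : B.Finite) (hprim : ∀ v ∈ B, IsPrimitive N v)
    (hB : B ⊆ L) (h0 : convexHull ℝ B ∈ 𝓝[(L : Set V)] (0 : V)) :
    IsFanoPolytope N L (convexHull ℝ B) where
  lattice := ⟨B, hfin, fun v hv => (hprim v hv).1, rfl⟩
  subset := convexHull_min hB L.convex
  zero_interior := h0
  vertices v hv := hprim v (extremePoints_convexHull_subset hv)

theorem IsFanoPolytope.reduction [FiniteDimensional ℝ V] [DiscreteTopology N]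
    (h : IsFanoPolytope N L P) (h' : IsFanoPolytope N L P')
    (hsub : primPoints N P' ⊆ primPoints N P)
    (hcard : (primPoints N P).ncard = (primPoints N P').ncard + 1) :
    IsFanoReduction N L P P' :=
  ⟨h, h', h.isPrimGenSet, h'.isPrimGenSet, hsub, hcard⟩

/-- An extreme point is not in the hull of the remaining points, so deleting a vertex loses exactly
one primitive point. The only obstruction to a reduction is that the origin may cease to be
interior. -/
theorem IsFanoPolytope.reduction_vertex [FiniteDimensional ℝ V] [DiscreteTopology N]
    (h : IsFanoPolytope N L P) (hv : v ∈ P.extremePoints ℝ)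
    (h0 : convexHull ℝ (primPoints N P \ {v}) ∈ 𝓝[(L : Set V)] (0 : V)) :
    IsFanoReduction N L P (convexHull ℝ (primPoints N P \ {v})) := by
  have hP : primPoints N P \ {v} ⊆ P \ {v} := Set.sdiff_subset_sdiff_left fun v hv => hv.1
  have h' : IsFanoPolytope N L (convexHull ℝ (primPoints N P \ {v})) :=
    isFanoPolytope_convexHull (h.finite_primPoints.subset Set.sdiff_subset)
      (fun v hv => hv.1.2) (fun v hv => h.subset hv.1.1) h0
  have e : primPoints N (convexHull ℝ (primPoints N P \ {v})) = primPoints N P \ {v} := by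
    apply Set.Subset.antisymm
    · rintro w ⟨hw, hwp⟩
      refine ⟨⟨convexHull_min (hP.trans Set.sdiff_subset) h.convex hw, hwp⟩, ?_⟩
      rintro rfl
      exact (h.convex.mem_extremePoints_iff_mem_sdiff_convexHull_sdiff.1 hv).2
        (convexHull_mono hP hw)
    · exact fun w hw => ⟨subset_convexHull ℝ _ hw, hw.1.2⟩
  apply h.reduction h'
  · rw [e]; exact Set.sdiff_subset
  · rw [e, Set.ncard_sdiff_singleton_add_one (h.extremePoints_subset hv) h.finite_primPoints]

theorem convexHull_le {φ : V →ₗ[ℝ] ℝ} {c : ℝ} (h : ∀ v ∈ B, φ v ≤ c) {w : V}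
    (hw : w ∈ convexHull ℝ B) : φ w ≤ c :=
  convexHull_min (t := {w | φ w ≤ c}) h (convex_halfSpace_le φ.isLinear c) hw

/-- A Fano polygon is not contained in a half plane. -/
theorem IsFanoPolytope.exists_pos (h : IsFanoPolytope N L P) (φ : V →ₗ[ℝ] ℝ)
    (hv : v ∈ L) (hφ : 0 < φ v) : ∃ w ∈ P.extremePoints ℝ, 0 < φ w := by
  by_contra! hc
  obtain ⟨c, h0, hcv⟩ := exists_smul_mem_of_mem_nhdsWithin h.zero_interior hv
  rw [← h.convexHull_extremePoints] at hcv
  have := convexHull_le (φ := φ) hc hcv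
  rw [map_smul, smul_eq_mul] at this
  nlinarith

/-- The weights `δ / (ε + δ)` and `ε / (ε + δ)` give both summands the same coefficient `ε δ / (ε +
δ)`. Absorbed directions can thus be treated like a cone. -/
theorem Convex.exists_smul_add_mem {C : Set V} (hC : Convex ℝ C)
    {a b : V} (ha : ∃ ε : ℝ, 0 < ε ∧ ε • a ∈ C) (hb : ∃ ε : ℝ, 0 < ε ∧ ε • b ∈ C) :
    ∃ ε : ℝ, 0 < ε ∧ ε • (a + b) ∈ C := by
  obtain ⟨ε, hε, ha⟩ := ha
  obtain ⟨δ, hδ, hb⟩ := hb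
  refine ⟨ε * δ / (ε + δ), by positivity, ?_⟩
  have := hC ha hb (a := δ / (ε + δ)) (b := ε / (ε + δ)) (by positivity) (by positivity)
    (by field_simp; ring)
  rw [smul_smul, smul_smul] at this
  rw [smul_add]
  convert this using 3 <;> ring

theorem exists_smul_smul_mem {C : Set V} (h0 : (0 : V) ∈ C)
    {a : V} (ha : ∃ ε : ℝ, 0 < ε ∧ ε • a ∈ C) {c : ℝ} (hc : 0 ≤ c) :
    ∃ ε : ℝ, 0 < ε ∧ ε • (c • a) ∈ C := by
  obtain ⟨ε, hε, ha⟩ := ha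
  rcases hc.eq_or_lt with rfl | hc
  · exact ⟨1, one_pos, by simpa using h0⟩
  · refine ⟨ε / c, by positivity, ?_⟩
    rwa [smul_smul, div_mul_cancel₀ _ hc.ne']

theorem exists_smul_mem_of_mem {C : Set V} {a : V} (ha : a ∈ C) :
    ∃ ε : ℝ, 0 < ε ∧ ε • a ∈ C :=
  ⟨1, one_pos, by rwa [one_smul]⟩

variable [FiniteDimensional ℝ V]

theorem IsLatticeBasis.mem_nhds (h : IsLatticeBasis N f g) {C : Set V} (hC : Convex ℝ C)
    {ε : ℝ} (hε : 0 < ε) (h1 : ε • f ∈ C) (h2 : (-ε) • f ∈ C) (h3 : ε • g ∈ C)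
    (h4 : (-ε) • g ∈ C) : C ∈ 𝓝 (0 : V) := by
  obtain ⟨x, y, hxy, -⟩ := h.exists_coord
  have aux : ∀ v : V, ε • v ∈ C → (-ε) • v ∈ C → ∀ t : ℝ, |t| < ε → t • v ∈ C := by
    intro v h1 h2 t ht
    rw [abs_lt] at ht
    have := hC h1 h2 (a := (ε + t) / (2 * ε)) (b := (ε - t) / (2 * ε))
      (div_nonneg (by linarith) (by linarith)) (div_nonneg (by linarith) (by linarith))
      (by field_simp; ring)
    rw [smul_smul, smul_smul, ← add_smul] at this
    convert this using 2
    field_simp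
    ring
  have cx : Continuous x := x.continuous_of_finiteDimensional
  have cy : Continuous y := y.continuous_of_finiteDimensional
  -- Each point of this parallelogram is the midpoint of `2 x f` and `2 y g`, which lie on the two
  -- segments contained in `C`.
  have hU : {v | |2 * x v| < ε} ∩ {v | |2 * y v| < ε} ∈ 𝓝 (0 : V) := by
    apply IsOpen.mem_nhds
    · exact (isOpen_lt (by fun_prop) continuous_const).inter
        (isOpen_lt (by fun_prop) continuous_const)
    · simp [hε]
  filter_upwards [hU] with v hv
  have := hC (aux f h1 h2 _ hv.1) (aux g h3 h4 _ hv.2) (a := 1 / 2) (b := 1 / 2)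
    (by norm_num) (by norm_num) (by norm_num)
  convert this using 1
  conv_lhs => rw [hxy v]
  module

/-- A convex set that absorbs every vector is a neighborhood of the origin. -/
theorem IsLatticeBasis.mem_nhds_of_absorbs (h : IsLatticeBasis N f g) {C : Set V}
    (hC : Convex ℝ C) (ha : ∀ v : V, ∃ ε : ℝ, 0 < ε ∧ ε • v ∈ C) : C ∈ 𝓝 (0 : V) := by
  obtain ⟨_, -, h0⟩ := ha 0
  rw [smul_zero] at h0
  have shrink : ∀ {ε δ : ℝ} {v : V}, 0 < δ → δ ≤ ε → ε • v ∈ C → δ • v ∈ C := by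
    intro ε δ v hδ hle hv
    have hε : 0 < ε := hδ.trans_le hle
    have := hC.smul_mem_of_zero_mem h0 hv (t := δ / ε)
      ⟨by positivity, (div_le_one hε).2 hle⟩
    rwa [smul_smul, div_mul_cancel₀ _ hε.ne'] at this
  obtain ⟨a, ha0, h1⟩ := ha f
  obtain ⟨b, hb0, h2⟩ := ha (-f)
  obtain ⟨c, hc0, h3⟩ := ha g
  obtain ⟨d, hd0, h4⟩ := ha (-g)
  have hm : 0 < min (min a b) (min c d) := by positivity
  refine h.mem_nhds hC hm (shrink hm ?_ h1) ?_ (shrink hm ?_ h3) ?_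
  · simp
  · rw [neg_smul, ← smul_neg]; exact shrink hm (by simp) h2
  · simp
  · rw [neg_smul, ← smul_neg]; exact shrink hm (by simp) h4

/-- A convex set containing three vectors in positive linear relation, two of which form a real
basis, is a neighborhood of the origin. -/
theorem IsLatticeBasis.mem_nhds_of_triple (h : IsLatticeBasis N f g) {C : Set V}
    (hC : Convex ℝ C) {a b c : V} (ha : a ∈ C) (hb : b ∈ C) (hc : c ∈ C)
    {α β γ : ℝ} (hα : 0 < α) (hβ : 0 < β) (hγ : 0 < γ) (e : α • a + β • b + γ • c = 0)
    (hspan : ∀ v : V, ∃ s t : ℝ, v = s • a + t • b) : C ∈ 𝓝 (0 : V) := by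
  have h0 : (0 : V) ∈ C := by
    have := hC.sum_mem (t := (Finset.univ : Finset (Fin 3)))
      (w := ![α / (α + β + γ), β / (α + β + γ), γ / (α + β + γ)]) (z := ![a, b, c])
      (by intro i _; fin_cases i <;> simp <;> positivity)
      (by simp [Fin.sum_univ_three]; field_simp)
      (by intro i _; fin_cases i <;> simp [ha, hb, hc])
    have e' : (0 : V) = (α + β + γ)⁻¹ • (α • a + β • b + γ • c) := by rw [e, smul_zero]
    rw [e']
    simp [Fin.sum_univ_three] at this
    convert this using 1
    module
  apply h.mem_nhds_of_absorbs hC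
  intro v
  obtain ⟨s, t, rfl⟩ := hspan v
  have hab := exists_smul_mem_of_mem ha
  have hbb := exists_smul_mem_of_mem hb
  have hcb := exists_smul_mem_of_mem hc
  -- Adding `k` times the positive relation changes nothing and makes all coefficients nonnegative;
  -- this `k` is large enough for both `s` and `t`.
  set k := |s| / α + |t| / β with hk
  have hk0 : 0 ≤ k := by positivity
  have h1 : 0 ≤ s + k * α := by
    have : |s| ≤ k * α := by
      rw [hk, add_mul, div_mul_cancel₀ _ hα.ne']
      have : 0 ≤ |t| / β * α := by positivity
      linarith
    linarith [neg_abs_le s]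
  have h2 : 0 ≤ t + k * β := by
    have : |t| ≤ k * β := by
      rw [hk, add_mul, div_mul_cancel₀ _ hβ.ne']
      have : 0 ≤ |s| / α * β := by positivity
      linarith
    linarith [neg_abs_le t]
  have e' : s • a + t • b = ((s + k * α) • a + (t + k * β) • b) + (k * γ) • c := by
    have : k • (α • a + β • b + γ • c) = 0 := by rw [e, smul_zero]
    rw [← sub_eq_zero, ← neg_eq_zero, ← this]
    module
  rw [e']
  exact Convex.exists_smul_add_mem hC (Convex.exists_smul_add_mem hC
    (exists_smul_smul_mem h0 hab h1) (exists_smul_smul_mem h0 hbb h2))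
    (exists_smul_smul_mem h0 hcb (by positivity))

/-- A convex set containing `f`, `-f` and points on both sides of the line through `f` is a
neighborhood of the origin. -/
theorem IsLatticeBasis.mem_nhds_of_pair (h : IsLatticeBasis N f g) {C : Set V}
    (hC : Convex ℝ C) (hf : f ∈ C) (hf' : -f ∈ C) {s t s' t' : ℝ} (ht : 0 < t) (ht' : t' < 0)
    (ha : s • f + t • g ∈ C) (hb : s' • f + t' • g ∈ C) : C ∈ 𝓝 (0 : V) := by
  have h0 : (0 : V) ∈ C := by
    have := hC hf hf' (a := 1 / 2) (b := 1 / 2) (by norm_num) (by norm_num) (by norm_num)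
    simpa using this
  have hline : ∀ c : ℝ, ∃ ε : ℝ, 0 < ε ∧ ε • (c • f) ∈ C := by
    intro c
    rcases le_total 0 c with hc | hc
    · exact exists_smul_smul_mem h0 (exists_smul_mem_of_mem hf) hc
    · have := exists_smul_smul_mem h0 (exists_smul_mem_of_mem hf') (c := -c) (by linarith)
      simpa using this
  apply h.mem_nhds_of_absorbs hC
  intro v
  obtain ⟨x, y, rfl⟩ := h.exists_eq v
  rcases le_total 0 y with hy | hy
  · have e : x • f + y • g = (x - y / t * s) • f + (y / t) • (s • f + t • g) := by
      have : y = y / t * t := by field_simp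
      conv_lhs => rw [this]
      module
    rw [e]
    exact Convex.exists_smul_add_mem hC (hline _)
      (exists_smul_smul_mem h0 (exists_smul_mem_of_mem ha) (by positivity))
  · have e : x • f + y • g = (x - y / t' * s') • f + (y / t') • (s' • f + t' • g) := by
      have : y = y / t' * t' := (div_mul_cancel₀ _ ht'.ne).symm
      conv_lhs => rw [this]
      module
    rw [e]
    exact Convex.exists_smul_add_mem hC (hline _)
      (exists_smul_smul_mem h0 (exists_smul_mem_of_mem hb) (div_nonneg_of_nonpos hy ht'.le))

end Polytope

/-! ### Fano polygons with three or four primitive points. -/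

section Classification

variable {V : Type*} [NormedAddCommGroup V] [NormedSpace ℝ V] {N : Submodule ℤ V}
  {P P' F B : Set V} {f g u v w : V}

/-- The triangle with vertices `0`, `f` and a lattice point above the line through `f` contains
a lattice point at height one. -/
theorem exists_height_one (f g : V) (m : ℤ) {n : ℤ} (hn : 0 < n) : ∃ (k : ℤ) (s t : ℝ),
    0 ≤ s ∧ 0 < t ∧ s + t ≤ 1 ∧
      (k : ℝ) • f + g = s • f + t • ((m : ℝ) • f + (n : ℝ) • g) := by
  have hn' : (0 : ℝ) < n := by exact_mod_cast hn
  -- Here `k` is `m / n` rounded up. The sharp upper bound `k n ≤ m + n - 1` is what keeps `s + t ≤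
  -- 1`.
  obtain ⟨k, hk1, hk2⟩ : ∃ k : ℤ, m ≤ k * n ∧ k * n ≤ m + n - 1 := by
    refine ⟨(m + n - 1) / n, ?_, Int.ediv_mul_le _ hn.ne'⟩
    have := Int.lt_ediv_add_one_mul_self (m + n - 1) hn
    nlinarith
  have hk1' : (m : ℝ) ≤ k * n := by exact_mod_cast hk1
  have hk2' : (k : ℝ) * n ≤ m + n - 1 := by exact_mod_cast hk2
  refine ⟨k, k - m / n, 1 / n, ?_, by positivity, ?_, ?_⟩
  · rw [sub_nonneg, div_le_iff₀ hn']; exact hk1'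
  · have : (k : ℝ) - m / n + 1 / n = (k * n - m + 1) / n := by field_simp
    rw [this, div_le_one hn']
    linarith
  · have : (1 : ℝ) / n * n = 1 := by field_simp
    rw [smul_add, smul_smul, smul_smul, this, ← add_assoc, ← add_smul, one_smul]
    congr 2
    field_simp
    ring

theorem convex_combination_mem {C : Set V} (hC : Convex ℝ C) (h0 : (0 : V) ∈ C) (hu : u ∈ C)
    (hv : v ∈ C) {s t : ℝ} (hs : 0 ≤ s) (ht : 0 ≤ t) (hst : s + t ≤ 1) : s • u + t • v ∈ C := by
  have := hC.sum_mem (t := (Finset.univ : Finset (Fin 3)))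
    (w := ![1 - s - t, s, t]) (z := ![0, u, v])
    (by intro i _; fin_cases i <;> simp <;> linarith)
    (by simp [Fin.sum_univ_three]; ring) (by intro i _; fin_cases i <;> simp [h0, hu, hv])
  simpa [Fin.sum_univ_three] using this

theorem mem_convexHull_sdiff {A : Set V} {a v : V} (h : a ∈ A) (hne : a ≠ v) :
    a ∈ convexHull ℝ (A \ {v}) :=
  subset_convexHull ℝ _ ⟨h, hne⟩

/-- The vertices of a polygon with fiber spanned by `±f` and sections at heights `±1`. -/
def ruledVertices (f g : V) (a c : ℤ) : Set V :=
  {f, -f, (a : ℝ) • f + g, (c : ℝ) • f - g}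

namespace IsLatticeBasis

theorem ncard_pair (h : IsLatticeBasis N f g) : ({f, -f} : Set V).ncard = 2 := by
  apply Set.ncard_pair
  intro e
  have := h.inj (x := 1) (y := 0) (x' := -1) (y' := 0) (by simpa using e)
  norm_num at this

theorem ncard_ruledVertices (h : IsLatticeBasis N f g) (a c : ℤ) :
    (ruledVertices f g a c).ncard = 4 := by
  obtain ⟨x, y, -, hxf, hxg, hyf, hyg⟩ := h.exists_coord
  have n1 : f ≠ -f := fun e => by
    have := congrArg x e; simp [hxf] at this; norm_num at this
  have n2 : (a : ℝ) • f + g ≠ (c : ℝ) • f - g := fun e => by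
    have := congrArg y e; simp [hyf, hyg] at this; norm_num at this
  have n3 : ∀ t : ℝ, (a : ℝ) • f + g ≠ t • f := fun t e => by
    have := congrArg y e; simp [hyf, hyg] at this
  have n4 : ∀ t : ℝ, (c : ℝ) • f - g ≠ t • f := fun t e => by
    have := congrArg y e; simp [hyf, hyg] at this
  have a1 := n3 1
  have a2 := n3 (-1)
  have b1 := n4 1
  have b2 := n4 (-1)
  simp only [one_smul, neg_smul] at a1 a2 b1 b2
  unfold ruledVertices
  rw [Set.ncard_insert_of_notMem (by simp [n1, a1.symm, b1.symm]),
    Set.ncard_insert_of_notMem (by simp [a2.symm, b2.symm]), Set.ncard_pair n2]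

theorem isPrimitive_ruledVertices (h : IsLatticeBasis N f g) (a c : ℤ) :
    ∀ v ∈ ruledVertices f g a c, IsPrimitive N v := by
  rintro v (rfl | rfl | rfl | rfl)
  · exact h.isPrimitive_left
  · exact h.isPrimitive_left.neg
  · exact h.isPrimitive_add a
  · rw [sub_eq_add_neg]; exact h.neg_right.isPrimitive_add c

theorem finite_ruledVertices (f g : V) (a c : ℤ) : (ruledVertices f g a c).Finite := by
  simp [ruledVertices]

/-- Some vertex lies above the line through `f`. The triangle it forms with `0` and `f` meets height
one in a lattice point, which is primitive because it completes `f` to a lattice basis. -/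
theorem exists_section (h : IsLatticeBasis N f g) (hP : IsFanoPolytope N ⊤ P)
    (hf : f ∈ P) : ∃ a : ℤ, (a : ℝ) • f + g ∈ primPoints N P := by
  obtain ⟨x, y, hxy, hxf, hxg, hyf, hyg⟩ := h.exists_coord
  obtain ⟨p, hp, hyp⟩ := hP.exists_pos y (v := g) trivial (by rw [hyg]; exact one_pos)
  have hpA := hP.extremePoints_subset hp
  obtain ⟨m, n, rfl⟩ := h.exists_int p hpA.2.1
  have hn : 0 < n := by
    simp [hyf, hyg] at hyp
    exact hyp
  obtain ⟨k, s, t, hs, ht, hst, e⟩ := exists_height_one f g m hn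
  refine ⟨k, ?_, h.isPrimitive_add k⟩
  rw [e]
  exact convex_combination_mem hP.convex hP.zero_mem hf hpA.1 hs ht.le hst

/-- A Fano polygon containing `±f` contains sections on both sides. -/
theorem exists_ruledVertices_subset (h : IsLatticeBasis N f g) (hP : IsFanoPolytope N ⊤ P)
    (hf : f ∈ primPoints N P) (hf' : -f ∈ primPoints N P) :
    ∃ a c : ℤ, ruledVertices f g a c ⊆ primPoints N P := by
  obtain ⟨a, ha⟩ := h.exists_section hP hf.1
  obtain ⟨c, hc⟩ := h.neg_right.exists_section hP hf.1
  refine ⟨a, c, ?_⟩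
  rintro v (rfl | rfl | rfl | rfl)
  · exact hf
  · exact hf'
  · exact ha
  · rw [sub_eq_add_neg]; exact hc

theorem exists_eq_ruledVertices [FiniteDimensional ℝ V] [DiscreteTopology N]
    (h : IsLatticeBasis N f g) (hP : IsFanoPolytope N ⊤ P)
    (hf : f ∈ primPoints N P) (hf' : -f ∈ primPoints N P) (hcard : (primPoints N P).ncard ≤ 4) :
    ∃ a c : ℤ, primPoints N P = ruledVertices f g a c := by
  obtain ⟨a, c, hsub⟩ := h.exists_ruledVertices_subset hP hf hf'
  refine ⟨a, c, (Set.eq_of_subset_of_ncard_le hsub ?_ hP.finite_primPoints).symm⟩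
  rwa [h.ncard_ruledVertices]

/-- Nonparallel primitive vectors form a real basis. -/
theorem real_basis (h : IsLatticeBasis N f g) (hu : IsPrimitive N u) (hv : IsPrimitive N v)
    (h1 : u ≠ v) (h2 : v ≠ -u) :
    (∀ x, ∃ s t : ℝ, x = s • u + t • v) ∧
      ∀ s t : ℝ, s • u + t • v = 0 → s = 0 ∧ t = 0 := by
  obtain ⟨q, hq⟩ := h.exists_basis hu
  obtain ⟨m, n, rfl⟩ := hq.exists_int v hv.1
  have hn : (n : ℝ) ≠ 0 := by
    intro hn
    rw [hn, zero_smul, add_zero] at hv h1 h2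
    rcases hq.eq_or_eq_neg hv rfl with ⟨-, h⟩ | ⟨-, h⟩
    · exact h1 h.symm
    · exact h2 h
  constructor
  · intro x
    obtain ⟨s, t, rfl⟩ := hq.exists_eq x
    refine ⟨s - t / n * m, t / n, ?_⟩
    have : t = t / n * n := (div_mul_cancel₀ _ hn).symm
    conv_lhs => rw [this]
    module
  · intro s t e
    have := hq.eq_zero (s + t * m) (t * n) (by rw [← e]; module)
    have ht : t = 0 := (mul_eq_zero.1 this.2).resolve_right hn
    refine ⟨?_, ht⟩
    simpa [ht] using this.1

/-- The origin of a Fano polygon is a positive combination of three vertices, unless the polygon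
contains a pair of opposite primitive points. -/
theorem exists_pair_or_triple [FiniteDimensional ℝ V] (h : IsLatticeBasis N f g)
    (hdim : Module.finrank ℝ V = 2) (hP : IsFanoPolytope N ⊤ P) :
    (∃ p ∈ primPoints N P, -p ∈ primPoints N P) ∨
    ∃ u ∈ P.extremePoints ℝ, ∃ v ∈ P.extremePoints ℝ, ∃ w ∈ P.extremePoints ℝ,
      u ≠ v ∧ u ≠ w ∧ v ≠ w ∧
      ∃ α β γ : ℝ, 0 < α ∧ 0 < β ∧ 0 < γ ∧ α • u + β • v + γ • w = 0 := by
  have h0 : (0 : V) ∈ convexHull ℝ (P.extremePoints ℝ) := by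
    rw [hP.convexHull_extremePoints]; exact hP.zero_mem
  -- Carathéodory's theorem: affine independence bounds the number of vertices by `dim + 1 = 3`, and
  -- all weights are positive.
  obtain ⟨ι, _, z, c, hz, hind, hc, hsum, hzero⟩ := eq_pos_convex_span_of_mem_convexHull h0
  have hcard : Fintype.card ι ≤ 3 := by
    have h1 := hind.card_le_finrank_succ
    have h2 := Submodule.finrank_le (vectorSpan ℝ (Set.range z))
    omega
  have hzE : ∀ i, z i ∈ P.extremePoints ℝ := fun i => hz ⟨i, rfl⟩
  have hzA : ∀ i, z i ∈ primPoints N P := fun i => hP.extremePoints_subset (hzE i)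
  obtain ⟨n, hn⟩ : ∃ n, Fintype.card ι = n := ⟨_, rfl⟩
  rw [hn] at hcard
  let e := Fintype.equivFinOfCardEq hn
  rw [← e.symm.sum_comp] at hzero hsum
  have hinj : ∀ i j, i ≠ j → z (e.symm i) ≠ z (e.symm j) := fun i j hij hh =>
    hij (e.symm.injective (hind.injective hh))
  clear_value e
  interval_cases n
  · simp at hsum
  · simp at hzero
    rcases hzero with hh | hh
    · exact absurd hh (hc _).ne'
    · exact absurd hh (hzA _).2.2.1
  · left
    rw [Fin.sum_univ_two] at hzero
    set p := z (e.symm 0)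
    set q := z (e.symm 1)
    set a := c (e.symm 0)
    set b := c (e.symm 1)
    have ha : 0 < a := hc _
    have hb : 0 < b := hc _
    have hpq : p = (-(b / a)) • q := by
      have h1 : a • p = -(b • q) := eq_neg_of_add_eq_zero_left hzero
      rw [neg_smul, div_eq_inv_mul, mul_smul, ← smul_neg, ← h1, smul_smul,
        inv_mul_cancel₀ ha.ne', one_smul]
    have hneg : -(b / a) < 0 := by
      have : 0 < b / a := by positivity
      linarith
    rcases h.parallel (hzA _).2 (hzA _).2 hpq with ⟨h1, -⟩ | ⟨-, h1⟩
    · linarith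
    · exact ⟨q, hzA _, h1 ▸ hzA _⟩
  · right
    rw [Fin.sum_univ_three] at hzero
    exact ⟨_, hzE _, _, hzE _, _, hzE _, hinj 0 1 (by decide), hinj 0 2 (by decide),
      hinj 1 2 (by decide), _, _, _, hc _, hc _, hc _, hzero⟩

/-- The triangle `0, u, v` contains a lattice point at height one over the line through `u`, and it
is primitive, hence one of `u, v, w`. It is not `u`, whose height is zero, nor `w`, which the
relation puts at negative height. So it is `v`, and `u, v` is a sheared lattice basis. -/
theorem of_triple (h : IsLatticeBasis N f g) (hP : IsFanoPolytope N ⊤ P)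
    (hA : primPoints N P = {u, v, w}) (huv : u ≠ v) (hneg : v ≠ -u)
    {α β γ : ℝ} (hβ : 0 < β) (hγ : 0 < γ) (e : α • u + β • v + γ • w = 0) :
    IsLatticeBasis N u v := by
  have hu : u ∈ primPoints N P := by simp [hA]
  have hv : v ∈ primPoints N P := by simp [hA]
  have hind := (h.real_basis hu.2 hv.2 huv hneg).2
  obtain ⟨q, hq⟩ : ∃ q, IsLatticeBasis N u q := h.exists_basis hu.2
  obtain ⟨q, hq, m, n, hn, hvq⟩ : ∃ q, IsLatticeBasis N u q ∧ ∃ m n : ℤ, 0 < n ∧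
      v = (m : ℝ) • u + (n : ℝ) • q := by
    obtain ⟨m, n, hvq⟩ := hq.exists_int v hv.2.1
    rcases lt_trichotomy n 0 with hn | hn | hn
    · exact ⟨-q, hq.neg_right, m, -n, by omega, by rw [hvq]; simp⟩
    · exfalso
      have := hind m (-1) (by rw [hvq, hn]; simp)
      norm_num at this
    · exact ⟨q, hq, m, n, hn, hvq⟩
  obtain ⟨k, s, t, hs, ht, hst, e'⟩ := exists_height_one u q m hn
  have hkA : (k : ℝ) • u + q ∈ primPoints N P := by
    refine ⟨?_, hq.isPrimitive_add k⟩
    rw [e', ← hvq]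
    exact convex_combination_mem hP.convex hP.zero_mem hu.1 hv.1 hs ht.le hst
  rw [hA] at hkA
  rcases hkA with h1 | h1 | h1
  · have := hq.inj (x := k) (y := 1) (x' := 1) (y' := 0) (by simpa using h1)
    norm_num at this
  · rw [← h1]
    exact hq.shear k
  · exfalso
    have := hind (α + γ * s) (β + γ * t) (by
      rw [← e, ← show (k : ℝ) • u + q = w from h1, e', ← hvq]
      module)
    nlinarith [mul_pos hγ ht]

/-- The coordinates of `w` in the basis are integers. Used for all three pairs of a triangle, this
makes the positive coefficients integer multiples of one another, hence equal. -/
theorem int_coefficients (h : IsLatticeBasis N u v) (hw : w ∈ N) {α β γ : ℝ}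
    (e : α • u + β • v + γ • w = 0) : ∃ m n : ℤ, α = m * γ ∧ β = n * γ := by
  obtain ⟨m, n, rfl⟩ := h.exists_int w hw
  have := h.eq_zero (α + γ * m) (β + γ * n) (by rw [← e]; module)
  refine ⟨-m, -n, ?_, ?_⟩
  · push_cast; linarith [this.1]
  · push_cast; linarith [this.2]

theorem eq_of_int_mul {a b : ℝ} (ha : 0 < a) (hb : 0 < b) {m n : ℤ} (h1 : a = m * b)
    (h2 : b = n * a) : a = b := by
  have h3 : (m : ℝ) * n = 1 := by
    have : (m * n : ℝ) * a = 1 * a := by linear_combination m * h2.symm - h1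
    exact mul_right_cancel₀ ha.ne' this
  have h4 : m * n = 1 := by exact_mod_cast h3
  have hm : 0 < m := by
    by_contra hm
    have : (m : ℝ) ≤ 0 := by exact_mod_cast not_lt.1 hm
    nlinarith
  have := Int.isUnit_iff.1 (IsUnit.of_mul_eq_one _ h4)
  have hm1 : m = 1 := by omega
  rw [h1, hm1]; simp

/-- A Fano polygon with three primitive points is the polygon of the projective plane. -/
theorem exists_eq_triangle [FiniteDimensional ℝ V] [DiscreteTopology N]
    (h : IsLatticeBasis N f g) (hdim : Module.finrank ℝ V = 2) (hP : IsFanoPolytope N ⊤ P)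
    (hcard : (primPoints N P).ncard = 3) :
    ∃ u v, IsLatticeBasis N u v ∧ primPoints N P = {u, v, -u - v} := by
  -- Opposite points would bring sections on both sides, hence at least four primitive points.
  have hpair : ∀ p ∈ primPoints N P, -p ∉ primPoints N P := by
    intro p hp hp'
    obtain ⟨q, hq⟩ := h.exists_basis hp.2
    obtain ⟨a, c, hsub⟩ := hq.exists_ruledVertices_subset hP hp hp'
    have := Set.ncard_le_ncard hsub hP.finite_primPoints
    rw [hq.ncard_ruledVertices] at this
    omega
  rcases h.exists_pair_or_triple hdim hP with ⟨p, hp, hp'⟩ | ht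
  · exact absurd hp' (hpair p hp)
  obtain ⟨u, hu, v, hv, w, hw, huv, huw, hvw, α, β, γ, hα, hβ, hγ, e⟩ := ht
  replace hu := hP.extremePoints_subset hu
  replace hv := hP.extremePoints_subset hv
  replace hw := hP.extremePoints_subset hw
  have hA : primPoints N P = {u, v, w} := by
    symm
    apply Set.eq_of_subset_of_ncard_le _ _ hP.finite_primPoints
    · rintro x (rfl | rfl | rfl) <;> assumption
    · rw [hcard, Set.ncard_eq_three.2 ⟨u, v, w, huv, huw, hvw, rfl⟩]
  have hne : ∀ {p q}, p ∈ primPoints N P → q ∈ primPoints N P → q ≠ -p := by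
    rintro p q hp hq rfl
    exact hpair p hp hq
  have e2 : α • u + γ • w + β • v = 0 := by rw [← e]; module
  have e3 : β • v + γ • w + α • u = 0 := by rw [← e]; module
  have b1 := h.of_triple hP hA huv (hne hu hv) hβ hγ e
  have b2 := h.of_triple hP (u := u) (v := w) (w := v) (by rw [hA]; congr 1; exact Set.pair_comm _ _)
    huw (hne hu hw) hγ hβ e2
  have b3 := h.of_triple hP (u := v) (v := w) (w := u)
    (by rw [hA, Set.insert_comm, Set.pair_comm u w]) hvw (hne hv hw) hγ hα e3
  obtain ⟨m1, n1, c1, c2⟩ := b1.int_coefficients hw.2.1 e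
  obtain ⟨m2, n2, c3, c4⟩ := b2.int_coefficients hv.2.1 e2
  obtain ⟨m3, n3, c5, c6⟩ := b3.int_coefficients hu.2.1 e3
  have hαγ : α = γ := eq_of_int_mul hα hγ c1 c6
  have hβγ : β = γ := eq_of_int_mul hβ hγ c2 c4
  refine ⟨u, v, b1, ?_⟩
  rw [hA]
  have : w = -u - v := by
    rw [hαγ, hβγ, ← smul_add, ← smul_add] at e
    have := (smul_eq_zero.1 e).resolve_left hγ.ne'
    rw [← sub_eq_zero, ← this]
    abel
  rw [this]

end IsLatticeBasis

end Classification

/-! ### Minimal Fano polygons. -/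

section Minimal

variable {V : Type*} [NormedAddCommGroup V] [NormedSpace ℝ V] [FiniteDimensional ℝ V]
  {N : Submodule ℤ V} [DiscreteTopology N] {P : Set V} {f g u v w a : V}

theorem IsMinimalFano.not_mem_nhds (h : IsMinimalFano N ⊤ P) (hv : v ∈ P.extremePoints ℝ) :
    convexHull ℝ (primPoints N P \ {v}) ∉ 𝓝 (0 : V) := fun h0 =>
  h.minimal ⟨_, h.fano.reduction_vertex hv (by rwa [Submodule.top_coe, nhdsWithin_univ])⟩

namespace IsLatticeBasis

/-- The vertex of a minimal polygon above a line through opposite primitive points is the only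
primitive point there. -/
theorem eq_of_pair (h : IsLatticeBasis N f g) (hP : IsMinimalFano N ⊤ P)
    (hf : f ∈ primPoints N P) (hf' : -f ∈ primPoints N P) {s t s' t' r r' : ℝ}
    (hu : s • f + t • g ∈ P.extremePoints ℝ) (ht : 0 < t)
    (hv : s' • f + t' • g ∈ primPoints N P) (ht' : t' < 0)
    (ha : r • f + r' • g ∈ primPoints N P) (hr' : 0 < r') :
    r • f + r' • g = s • f + t • g := by
  by_contra hne
  refine hP.not_mem_nhds hu (h.mem_nhds_of_pair (convex_convexHull ℝ _)
    (mem_convexHull_sdiff hf fun e => ?_) (mem_convexHull_sdiff hf' fun e => ?_) hr' ht'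
    (mem_convexHull_sdiff ha hne) (mem_convexHull_sdiff hv fun e => ?_))
  · have := (h.inj (x := 1) (y := 0) (by simpa using e)).2
    linarith
  · have := (h.inj (x := -1) (y := 0) (by simpa using e)).2
    linarith
  · have := (h.inj e).2
    linarith

/-- The points are sorted by the sign of their height: `eq_of_pair`, applied to `g` and to `-g`,
leaves one above and one below, and on the line only `±f` are primitive. -/
theorem ncard_le_four_of_pair (h : IsLatticeBasis N f g) (hP : IsMinimalFano N ⊤ P)
    (hf : f ∈ primPoints N P) (hf' : -f ∈ primPoints N P) : (primPoints N P).ncard ≤ 4 := by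
  classical
  obtain ⟨x, y, hxy, hxf, hxg, hyf, hyg⟩ := h.exists_coord
  obtain ⟨u, hu, hyu⟩ := hP.fano.exists_pos y (v := g) trivial (by rw [hyg]; exact one_pos)
  obtain ⟨v, hv, hyv⟩ := hP.fano.exists_pos (-y) (v := -g) trivial (by simp [hyg])
  rw [LinearMap.neg_apply, neg_pos] at hyv
  have huA := hP.fano.extremePoints_subset hu
  have hvA := hP.fano.extremePoints_subset hv
  have hsub : primPoints N P ⊆ (({f, -f, u, v} : Finset V) : Set V) := by
    intro a ha
    simp only [Finset.coe_insert, Finset.coe_singleton]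
    rcases lt_trichotomy (y a) 0 with hya | hya | hya
    · have := h.neg_right.eq_of_pair hP hf hf' (s := x v) (t := -y v) (s' := x u) (t' := -y u)
        (r := x a) (r' := -y a) (by simpa [← hxy] using hv) (by linarith)
        (by simpa [← hxy] using huA) (by linarith) (by simpa [← hxy] using ha) (by linarith)
      simp only [smul_neg, neg_smul, neg_neg, ← hxy] at this
      simp [this]
    · have e : a = x a • f := by
        conv_lhs => rw [hxy a, hya]
        simp
      rcases h.eq_or_eq_neg ha.2 e with ⟨-, h1⟩ | ⟨-, h1⟩ <;> simp [h1]
    · have := h.eq_of_pair hP hf hf' (s := x u) (t := y u) (s' := x v) (t' := y v)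
        (r := x a) (r' := y a) (by simpa [← hxy] using hu) (by linarith)
        (by simpa [← hxy] using hvA) (by linarith) (by simpa [← hxy] using ha) (by linarith)
      simp only [← hxy] at this
      simp [this]
  have := Set.ncard_le_ncard hsub (Finset.finite_toSet _)
  rw [Set.ncard_coe_finset] at this
  exact this.trans Finset.card_le_four

/-- Eliminating `u` from the relation gives `(α/s) a + (β - α t/s) v + γ w = 0`. By `hst` its
coefficients are positive, so the origin remains interior after `u` is deleted. Geometrically, `a`
lies on the same side of the ray of `-w` as `u`. -/
theorem not_mem_of_triple_aux (h : IsLatticeBasis N f g) (hP : IsMinimalFano N ⊤ P)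
    (hpair : ∀ p ∈ primPoints N P, -p ∉ primPoints N P)
    (hu : u ∈ P.extremePoints ℝ) (hv : v ∈ primPoints N P) (hw : w ∈ primPoints N P)
    (huv : u ≠ v) (huw : u ≠ w) {α β γ : ℝ} (hα : 0 < α) (hγ : 0 < γ)
    (e : α • u + β • v + γ • w = 0) (ha : a ∈ primPoints N P) (hau : a ≠ u) (hav : a ≠ v)
    {s t : ℝ} (hs : 0 < s) (hst : t * α < s * β) (ea : a = s • u + t • v) : False := by
  have hb := h.real_basis ha.2 hv.2 hav (fun e => hpair a ha (e ▸ hv))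
  refine hP.not_mem_nhds hu (h.mem_nhds_of_triple (convex_convexHull ℝ _)
    (mem_convexHull_sdiff ha hau) (mem_convexHull_sdiff hv huv.symm)
    (mem_convexHull_sdiff hw huw.symm) (α := α / s) (β := β - α * t / s) (γ := γ)
    (by positivity) ?_ hγ ?_ hb.1)
  · rw [sub_pos, div_lt_iff₀ hs]; linarith
  · rw [← e, ea]
    have : α / s * s = α := div_mul_cancel₀ _ hs.ne'
    have h2 : α * t / s = α / s * t := by ring
    rw [h2]
    conv_rhs => rw [← this]
    module

/-- The ray of `-w` divides the cone over `u, v`. On one side `a` makes `u` superfluous, on the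
other it makes `v` superfluous, and on the ray itself `a` would be the opposite of `w`. -/
theorem not_mem_of_triple (h : IsLatticeBasis N f g) (hP : IsMinimalFano N ⊤ P)
    (hpair : ∀ p ∈ primPoints N P, -p ∉ primPoints N P)
    (hu : u ∈ P.extremePoints ℝ) (hv : v ∈ P.extremePoints ℝ) (hw : w ∈ P.extremePoints ℝ)
    (huv : u ≠ v) (huw : u ≠ w) (hvw : v ≠ w)
    {α β γ : ℝ} (hα : 0 < α) (hβ : 0 < β) (hγ : 0 < γ)
    (e : α • u + β • v + γ • w = 0) (ha : a ∈ primPoints N P) (hau : a ≠ u) (hav : a ≠ v)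
    (haw : a ≠ w) {s t : ℝ} (hs : 0 ≤ s) (ht : 0 ≤ t) (ea : a = s • u + t • v) : False := by
  have huA := hP.fano.extremePoints_subset hu
  have hvA := hP.fano.extremePoints_subset hv
  have hwA := hP.fano.extremePoints_subset hw
  have key : ∀ p ∈ primPoints N P, a ≠ p → ∀ c : ℝ, a ≠ c • p := by
    intro p hp hap c hc
    rcases h.parallel ha.2 hp.2 hc with ⟨-, h1⟩ | ⟨-, h1⟩
    · exact hap h1
    · exact hpair p hp (h1 ▸ ha)
  have hs' : 0 < s := hs.lt_of_ne fun h0 => key v hvA hav t (by rw [ea, ← h0]; simp)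
  have ht' : 0 < t := ht.lt_of_ne fun h0 => key u huA hau s (by rw [ea, ← h0]; simp)
  rcases lt_trichotomy (t * α) (s * β) with h1 | h1 | h1
  · exact h.not_mem_of_triple_aux hP hpair hu hvA hwA huv huw hα hγ e ha hau hav hs' h1 ea
  · apply key w hwA haw (-(s / α * γ))
    have h2 : t = s / α * β := by field_simp; linarith
    have h3 : s = s / α * α := by field_simp
    have h4 : (s / α) • (α • u + β • v + γ • w) = 0 := by rw [e, smul_zero]
    rw [ea, ← sub_eq_zero, ← h4, h2]
    conv_lhs => rw [h3]
    have h5 : s / α * α / α = s / α := by field_simp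
    rw [h5]
    module
  · exact h.not_mem_of_triple_aux hP hpair hv huA hwA huv.symm hvw hβ hγ
      (by rw [← e]; module) ha hav hau ht' h1 (by rw [ea, add_comm])

/-- A minimal Fano polygon contains opposite primitive points or has three primitive points. -/
theorem minimal_cases (h : IsLatticeBasis N f g) (hdim : Module.finrank ℝ V = 2)
    (hP : IsMinimalFano N ⊤ P) :
    (∃ p ∈ primPoints N P, -p ∈ primPoints N P) ∨ (primPoints N P).ncard = 3 := by
  by_contra! hcon
  obtain ⟨hpair, hcard⟩ := hcon
  rcases h.exists_pair_or_triple hdim hP.fano with ⟨p, hp, hp'⟩ | ht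
  · exact hpair p hp hp'
  obtain ⟨u, hu, v, hv, w, hw, huv, huw, hvw, α, β, γ, hα, hβ, hγ, e⟩ := ht
  have huA := hP.fano.extremePoints_subset hu
  have hvA := hP.fano.extremePoints_subset hv
  have hwA := hP.fano.extremePoints_subset hw
  apply hcard
  rw [Set.ncard_eq_three]
  refine ⟨u, v, w, huv, huw, hvw, ?_⟩
  symm
  apply Set.Subset.antisymm
  · rintro x (rfl | rfl | rfl) <;> assumption
  intro a ha
  by_contra hmem
  simp only [Set.mem_insert_iff, Set.mem_singleton_iff, not_or] at hmem
  obtain ⟨hau, hav, haw⟩ := hmem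
  obtain ⟨s, t, ea⟩ := (h.real_basis huA.2 hvA.2 huv (fun e => hpair u huA (e ▸ hvA))).1 a
  -- The three cones over pairs of vertices cover the plane: subtracting the relation times the
  -- least of `s / α`, `t / β` and `0` leaves nonnegative coefficients, one of which vanishes. The
  -- cases below follow which of the three is least.
  have ea' : ∀ k : ℝ, a = (s + k * α) • u + (t + k * β) • v + (k * γ) • w := by
    intro k
    have h4 : k • (α • u + β • v + γ • w) = 0 := by rw [e, smul_zero]
    rw [ea, ← sub_eq_zero, ← neg_eq_zero, ← h4]
    module
  have hsα : s + -(s / α) * α = 0 := by field_simp; ring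
  have htβ : t + -(t / β) * β = 0 := by field_simp; ring
  by_cases hpos : 0 ≤ s ∧ 0 ≤ t
  · exact h.not_mem_of_triple hP hpair hu hv hw huv huw hvw hα hβ hγ e ha hau hav haw
      hpos.1 hpos.2 ea
  rcases le_total (s / α) (t / β) with hle | hle
  · have hs : s / α ≤ 0 := by
      by_contra! hs
      apply hpos
      have h1 := mul_pos hs hα
      have h2 := mul_pos (hs.trans_le hle) hβ
      rw [div_mul_cancel₀ _ hα.ne'] at h1
      rw [div_mul_cancel₀ _ hβ.ne'] at h2
      exact ⟨h1.le, h2.le⟩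
    have h1 := ea' (-(s / α))
    rw [hsα, zero_smul, zero_add] at h1
    refine h.not_mem_of_triple hP hpair hv hw hu hvw huv.symm huw.symm hβ hγ hα
      (by rw [← e]; module) ha hav haw hau ?_ (mul_nonneg (by linarith) hγ.le) h1
    have := mul_le_mul_of_nonneg_right hle hβ.le
    rw [div_mul_cancel₀ _ hβ.ne'] at this
    linarith
  · have ht : t / β ≤ 0 := by
      by_contra! ht
      apply hpos
      have h1 := mul_pos ht hβ
      have h2 := mul_pos (ht.trans_le hle) hα
      rw [div_mul_cancel₀ _ hβ.ne'] at h1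
      rw [div_mul_cancel₀ _ hα.ne'] at h2
      exact ⟨h2.le, h1.le⟩
    have h1 := ea' (-(t / β))
    rw [htβ, zero_smul, add_zero] at h1
    refine h.not_mem_of_triple hP hpair hu hw hv huw huv hvw.symm hα hγ hβ
      (by rw [← e]; module) ha hau haw hav ?_ (mul_nonneg (by linarith) hγ.le) h1
    have := mul_le_mul_of_nonneg_right hle hα.le
    rw [div_mul_cancel₀ _ hα.ne'] at this
    linarith

end IsLatticeBasis

end Minimal

/-! ### Mori fiber structures and their classification. -/

section Fiber

variable {V : Type*} [NormedAddCommGroup V] [NormedSpace ℝ V] {N : Submodule ℤ V}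
  {P F : Set V} {f g v : V}

theorem MoriFiberPolytope.eq_of_total_of_fiber {X Y : MoriFiberPolytope N}
    (h1 : X.total = Y.total) (h2 : X.fiber = Y.fiber) : X = Y := by
  cases X
  cases Y
  cases h1
  cases h2
  rfl

namespace IsLatticeBasis

theorem mkQ_combination {L : Submodule ℝ V} (hL : L = Submodule.span ℝ {f}) (g : V) (x y : ℝ) :
    L.mkQ (x • f + y • g) = y • L.mkQ g := by
  have : L.mkQ f = 0 := by
    rw [Submodule.mkQ_apply, Submodule.Quotient.mk_eq_zero, hL]
    exact Submodule.mem_span_singleton_self f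
  rw [map_add, map_smul, map_smul, this, smul_zero, zero_add]

theorem mkQ_ne_zero (h : IsLatticeBasis N f g) {L : Submodule ℝ V}
    (hL : L = Submodule.span ℝ {f}) : L.mkQ g ≠ 0 := by
  rw [Submodule.mkQ_apply, Ne, Submodule.Quotient.mk_eq_zero, hL, Submodule.mem_span_singleton]
  rintro ⟨c, hc⟩
  have := h.eq_zero c (-1) (by rw [hc]; simp)
  norm_num at this

/-- The quotient of the lattice by the line through a basis vector has two primitive points. -/
theorem isPrimitive_quotientLattice_iff (h : IsLatticeBasis N f g) {L : Submodule ℝ V}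
    (hL : L = Submodule.span ℝ {f}) (w : V ⧸ L) :
    IsPrimitive (quotientLattice N L) w ↔ w = L.mkQ g ∨ w = -L.mkQ g := by
  have hmem : ∀ w ∈ quotientLattice N L, ∃ n : ℤ, w = (n : ℝ) • L.mkQ g := by
    rintro _ ⟨v, hv, rfl⟩
    obtain ⟨m, n, rfl⟩ := h.exists_int v hv
    exact ⟨n, mkQ_combination hL g m n⟩
  have hg : L.mkQ g ∈ quotientLattice N L := ⟨g, h.right_mem, rfl⟩
  have hprim : IsPrimitive (quotientLattice N L) (L.mkQ g) := by
    refine ⟨hg, h.mkQ_ne_zero hL, fun w hw k e => ?_⟩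
    obtain ⟨n, rfl⟩ := hmem w hw
    rw [← Nat.cast_smul_eq_nsmul ℝ, smul_smul] at e
    have e' : ((k : ℝ) * n - 1) • L.mkQ g = 0 := by rw [sub_smul, ← e, one_smul, sub_self]
    have := (smul_eq_zero.1 e').resolve_right (h.mkQ_ne_zero hL)
    have h2 : (k : ℤ) * n = 1 := by
      have : (k : ℝ) * n = 1 := by linarith
      exact_mod_cast this
    have := Int.isUnit_iff.1 (IsUnit.of_mul_eq_one _ h2)
    omega
  constructor
  · intro hw
    obtain ⟨n, e⟩ := hmem w hw.1
    rcases hw.natAbs_eq_one hg e with rfl | rfl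
    · left; simpa using e
    · right; simpa using e
  · rintro (rfl | rfl)
    · exact hprim
    · exact hprim.neg

theorem base_subset (h : IsLatticeBasis N f g) {A Af : Set V}
    (hL : Submodule.span ℝ Af = Submodule.span ℝ {f}) :
    base N A Af ⊆ {(Submodule.span ℝ Af).mkQ g, -(Submodule.span ℝ Af).mkQ g} :=
  fun _ hw => (h.isPrimitive_quotientLattice_iff hL _).1 hw.1

theorem ncard_base_le (h : IsLatticeBasis N f g) {A Af : Set V}
    (hL : Submodule.span ℝ Af = Submodule.span ℝ {f}) : (base N A Af).ncard ≤ 2 :=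
  (Set.ncard_le_ncard (h.base_subset hL) (Set.toFinite _)).trans (Set.ncard_insert_le _ _ |>.trans
    (by rw [Set.ncard_singleton]))

theorem ncard_base_eq (h : IsLatticeBasis N f g) {A Af : Set V}
    (hL : Submodule.span ℝ Af = Submodule.span ℝ {f}) {s s' : ℝ}
    (h1 : s • f + g ∈ A \ Af) (h2 : s' • f - g ∈ A \ Af) : (base N A Af).ncard = 2 := by
  have e : base N A Af = {(Submodule.span ℝ Af).mkQ g, -(Submodule.span ℝ Af).mkQ g} := by
    apply Set.Subset.antisymm (h.base_subset hL)
    intro w hw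
    refine ⟨(h.isPrimitive_quotientLattice_iff hL _).2 hw, ?_⟩
    rcases hw with rfl | rfl
    · refine ⟨_, h1, 1, one_pos, ?_⟩
      have := mkQ_combination hL g s 1
      rw [one_smul, one_smul] at this
      rw [this, one_smul]
    · refine ⟨_, h2, 1, one_pos, ?_⟩
      have := mkQ_combination hL g s' (-1)
      rw [neg_smul, one_smul, neg_smul, one_smul, ← sub_eq_add_neg] at this
      rw [this, one_smul]
  rw [e]
  apply Set.ncard_pair
  intro hq
  apply h.mkQ_ne_zero hL
  have : (2 : ℝ) • (Submodule.span ℝ Af).mkQ g = 0 := by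
    rw [two_smul]; conv_lhs => enter [2]; rw [hq]
    simp
  exact (smul_eq_zero.1 this).resolve_left (by norm_num)

theorem span_pair_neg (f : V) : Submodule.span ℝ {f, -f} = Submodule.span ℝ {f} := by
  apply le_antisymm
  · rw [Submodule.span_le]
    have := Submodule.mem_span_singleton_self (R := ℝ) f
    rintro x (rfl | rfl)
    · exact this
    · exact Submodule.neg_mem _ this
  · exact Submodule.span_mono (by simp)

theorem finrank_span (h : IsLatticeBasis N f g) :
    Module.finrank ℝ (Submodule.span ℝ {f}) = 1 :=
  finrank_span_singleton h.left_ne_zero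

theorem primitive_mem_span (h : IsLatticeBasis N f g) (hv : IsPrimitive N v)
    (hs : v ∈ Submodule.span ℝ {f}) : v ∈ ({f, -f} : Set V) := by
  obtain ⟨c, hc⟩ := Submodule.mem_span_singleton.1 hs
  rcases h.eq_or_eq_neg hv hc.symm with ⟨-, h1⟩ | ⟨-, h1⟩ <;> simp [h1]

theorem primPoints_fiber (h : IsLatticeBasis N f g) :
    primPoints N (convexHull ℝ {f, -f}) = {f, -f} := by
  apply Set.Subset.antisymm
  · rintro v ⟨hv, hp⟩
    apply h.primitive_mem_span hp
    rw [← span_pair_neg]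
    exact convexHull_min Submodule.subset_span (Submodule.convex _) hv
  · intro v hv
    refine ⟨subset_convexHull ℝ _ hv, ?_⟩
    rcases hv with rfl | rfl
    · exact h.isPrimitive_left
    · exact h.isPrimitive_left.neg

variable [FiniteDimensional ℝ V]

theorem isFanoPolytope_fiber (h : IsLatticeBasis N f g) :
    IsFanoPolytope N (Submodule.span ℝ {f}) (convexHull ℝ {f, -f}) := by
  apply isFanoPolytope_convexHull
  · exact Set.toFinite _
  · rintro v (rfl | rfl)
    · exact h.isPrimitive_left
    · exact h.isPrimitive_left.neg
  · rw [← span_pair_neg]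
    exact Submodule.subset_span
  · obtain ⟨x, y, hxy, hxf, hxg, hyf, hyg⟩ := h.exists_coord
    have cx : Continuous x := x.continuous_of_finiteDimensional
    have hU : {v | |x v| < 1} ∈ 𝓝 (0 : V) :=
      IsOpen.mem_nhds (isOpen_lt (by fun_prop) continuous_const) (by simp)
    filter_upwards [mem_nhdsWithin_of_mem_nhds hU, self_mem_nhdsWithin] with v hv hs
    obtain ⟨c, rfl⟩ := Submodule.mem_span_singleton.1 hs
    simp only [map_smul, hxf, smul_eq_mul, mul_one, abs_lt] at hv
    have h1 : f ∈ convexHull ℝ {f, -f} := subset_convexHull ℝ _ (by simp)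
    have h2 : -f ∈ convexHull ℝ {f, -f} := subset_convexHull ℝ _ (by simp)
    have := convex_convexHull ℝ {f, -f} h1 h2 (a := (1 + c) / 2) (b := (1 - c) / 2)
      (by linarith) (by linarith) (by ring)
    convert this using 1
    module

variable [DiscreteTopology N]

theorem span_primPoints_fiber (h : IsLatticeBasis N f g) :
    Submodule.span ℝ (primPoints N (convexHull ℝ {f, -f})) = Submodule.span ℝ {f} :=
  h.isFanoPolytope_fiber.span_primPoints

theorem isFanoFiberStructure (h : IsLatticeBasis N f g) (hP : IsFanoPolytope N ⊤ P)
    (hf : f ∈ primPoints N P) (hf' : -f ∈ primPoints N P) :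
    IsFanoFiberStructure N ⊤ P (convexHull ℝ {f, -f}) where
  total := hP
  fiber := by rw [h.isFanoPolytope_fiber.span_eq]; exact h.isFanoPolytope_fiber
  fiberStructure :=
    { total := hP.isPrimGenSet
      nonempty := by rw [h.primPoints_fiber]; exact ⟨f, by simp⟩
      fiber := by
        rw [h.span_primPoints_fiber]
        exact h.isFanoPolytope_fiber.isPrimGenSet
      eq_inter := by
        rw [h.span_primPoints_fiber, h.primPoints_fiber]
        apply Set.Subset.antisymm
        · rintro v (rfl | rfl)
          · exact ⟨Submodule.mem_span_singleton_self _, hf⟩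
          · exact ⟨Submodule.neg_mem _ (Submodule.mem_span_singleton_self _), hf'⟩
        · exact fun v hv => h.primitive_mem_span hv.2.2 hv.1 }

/-- The two sections map onto the two primitive points of the quotient lattice, so irreducibility
reads `4 = 2 + 2`; the fiber condition reads `2 = 1 + 1`. -/
theorem isFanoMoriFiberStructure (h : IsLatticeBasis N f g) (hP : IsFanoPolytope N ⊤ P)
    {a c : ℤ} (hA : primPoints N P = ruledVertices f g a c) :
    IsFanoMoriFiberStructure N ⊤ P (convexHull ℝ {f, -f}) := by
  have hfs := h.isFanoFiberStructure hP (by simp [hA, ruledVertices])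
    (by simp [hA, ruledVertices])
  refine ⟨hP, hfs.fiber, hfs.fiberStructure, ?_, ?_⟩
  · have hnot : ∀ t : ℝ, ∀ y : ℝ, y ≠ 0 → t • f + y • g ∉ ({f, -f} : Set V) := by
      rintro t y hy (e | e)
      · exact hy (h.inj (x' := 1) (y' := 0) (by simpa using e)).2
      · exact hy (h.inj (x' := -1) (y' := 0) (by simpa using e)).2
    rw [h.ncard_base_eq h.span_primPoints_fiber (s := a) (s' := c), hA,
      h.ncard_ruledVertices, h.primPoints_fiber, h.ncard_pair]
    · rw [hA, h.primPoints_fiber]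
      exact ⟨by simp [ruledVertices], by simpa using hnot a 1 one_ne_zero⟩
    · rw [hA, h.primPoints_fiber]
      exact ⟨by simp [ruledVertices], by
        simpa [← sub_eq_add_neg] using hnot c (-1) (by norm_num)⟩
  · rw [h.span_primPoints_fiber, h.finrank_span, h.primPoints_fiber, h.ncard_pair]

end IsLatticeBasis

variable [FiniteDimensional ℝ V] [DiscreteTopology N]

theorem IsFanoPolytope.isFanoFiberStructure_self (hP : IsFanoPolytope N ⊤ P)
    (hne : (primPoints N P).Nonempty) : IsFanoFiberStructure N ⊤ P P where
  total := hP
  fiber := by rw [hP.span_eq]; exact hP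
  fiberStructure :=
    { total := hP.isPrimGenSet
      nonempty := hne
      fiber := by rw [hP.span_primPoints]; exact hP.isPrimGenSet
      eq_inter := by rw [hP.span_primPoints]; simp }

/-- The base is empty, and the fiber condition reads `3 = 2 + 1`. -/
theorem IsFanoPolytope.isFanoMoriFiberStructure_self (hP : IsFanoPolytope N ⊤ P)
    (hdim : Module.finrank ℝ V = 2) (hcard : (primPoints N P).ncard = 3) :
    IsFanoMoriFiberStructure N ⊤ P P := by
  have hfs := hP.isFanoFiberStructure_self (Set.nonempty_of_ncard_ne_zero (by omega))
  refine ⟨hP, hfs.fiber, hfs.fiberStructure, ?_, ?_⟩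
  · have : base N (primPoints N P) (primPoints N P) = ∅ := by
      ext w
      simp [base]
    rw [this, Set.ncard_empty, add_zero]
  · rw [hP.span_primPoints, finrank_top, hdim, hcard]

theorem IsMinimalFano.exists_isFanoMoriFiberStructure (hP : IsMinimalFano N ⊤ P)
    (h : IsLatticeBasis N f g) (hdim : Module.finrank ℝ V = 2) :
    ∃ F : Set V, IsFanoMoriFiberStructure N ⊤ P F := by
  rcases h.minimal_cases hdim hP with ⟨p, hp, hp'⟩ | hcard
  · obtain ⟨q, hq⟩ := h.exists_basis hp.2
    obtain ⟨a, c, hA⟩ := hq.exists_eq_ruledVertices hP.fano hp hp'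
      (hq.ncard_le_four_of_pair hP hp hp')
    exact ⟨_, hq.isFanoMoriFiberStructure hP.fano hA⟩
  · exact ⟨P, hP.fano.isFanoMoriFiberStructure_self hdim hcard⟩

/-- Mori fiber polygons have either three primitive points or a one-dimensional fiber. -/
theorem MoriFiberPolytope.classification (X : MoriFiberPolytope N)
    (h : IsLatticeBasis N f g) (hdim : Module.finrank ℝ V = 2) :
    ((primPoints N X.total).ncard = 3 ∧ X.fiber = X.total) ∨
    ∃ p q, IsLatticeBasis N p q ∧ X.fiber = convexHull ℝ {p, -p} ∧
      ∃ a c : ℤ, X.total = convexHull ℝ (ruledVertices p q a c) := by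
  have hX := X.isMori
  have hM := hX.moriFiberStructure
  obtain ⟨p, hp⟩ := hM.nonempty
  have hpL : p ∈ Submodule.span ℝ (primPoints N X.fiber) := Submodule.subset_span hp
  have hle := Submodule.finrank_le (Submodule.span ℝ (primPoints N X.fiber))
  have hcard := hM.card
  obtain ⟨d, hd⟩ : ∃ d, Module.finrank ℝ (Submodule.span ℝ (primPoints N X.fiber)) = d :=
    ⟨_, rfl⟩
  rw [hd] at hcard hle
  rw [hdim] at hle
  interval_cases d
  · rw [Submodule.finrank_eq_zero] at hd
    rw [hd, Submodule.mem_bot] at hpL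
    exact absurd hpL hp.2.2.1
  · right
    obtain ⟨q, hq⟩ := h.exists_basis hp.2
    have hL : Submodule.span ℝ (primPoints N X.fiber) = Submodule.span ℝ {p} := by
      symm
      apply Submodule.eq_of_le_of_finrank_eq
      · rw [Submodule.span_singleton_le_iff_mem]; exact hpL
      · rw [hd, hq.finrank_span]
    have hAf : primPoints N X.fiber = {p, -p} := by
      apply Set.eq_of_subset_of_ncard_le _ _ (Set.toFinite _)
      · intro v hv
        apply hq.primitive_mem_span hv.2
        rw [← hL]
        exact Submodule.subset_span hv
      · rw [hcard, hq.ncard_pair]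
    have hsub : primPoints N X.fiber ⊆ primPoints N X.total := by
      rw [hM.eq_inter]; exact Set.inter_subset_right
    -- The fiber has two points and the base at most two, so irreducibility leaves at most four
    -- primitive points in all.
    have hirr := hM.irreducible
    have hbase := hq.ncard_base_le (A := primPoints N X.total) hL
    obtain ⟨a, c, hA⟩ := hq.exists_eq_ruledVertices hX.total (hsub hp)
      (hsub (by rw [hAf]; simp)) (by omega)
    exact ⟨p, q, hq, by rw [← hAf, hX.fiber.convexHull_primPoints], a, c,
      by rw [← hA, hX.total.convexHull_primPoints]⟩
  · left
    have hL : Submodule.span ℝ (primPoints N X.fiber) = ⊤ :=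
      Submodule.eq_top_of_finrank_eq (by rw [hd, hdim])
    have e : primPoints N X.fiber = primPoints N X.total := by
      have := hM.eq_inter
      rw [hL] at this
      simpa using this
    exact ⟨by rw [← e, hcard], hX.fiber.eq_of_primPoints hX.total e⟩

end Fiber

/-! ### Ruled polygons and their primitive points. -/

section Links

variable {V : Type*} [NormedAddCommGroup V] [NormedSpace ℝ V] {N : Submodule ℤ V}
  {P F : Set V} {f g u v : V}

namespace IsLatticeBasis

/-- The primitive points of a polygon with two adjacent sections above the fiber are exactly the
evident ones. -/
theorem primPoints_convexHull_insert (h : IsLatticeBasis N f g) (a c : ℤ) {b : ℤ}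
    (hb : b = a ∨ b = a + 1) :
    primPoints N (convexHull ℝ (insert ((b : ℝ) • f + g) (ruledVertices f g a c))) =
      insert ((b : ℝ) • f + g) (ruledVertices f g a c) := by
  apply Set.Subset.antisymm
  swap
  · intro v hv
    refine ⟨subset_convexHull ℝ _ hv, ?_⟩
    rcases hv with rfl | hv
    · exact h.isPrimitive_add b
    · exact h.isPrimitive_ruledVertices a c v hv
  obtain ⟨x, y, -, hxf, hxg, hyf, hyg⟩ := h.exists_coord
  rintro v ⟨hv, hp⟩
  obtain ⟨m, n, rfl⟩ := h.exists_int v hp.1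
  have hba : (a : ℝ) ≤ b ∧ (b : ℝ) ≤ a + 1 := by
    rcases hb with rfl | rfl <;> constructor <;> push_cast <;> linarith
  -- A linear functional bounded by `γ` on the five generators is bounded by `γ` at the given point.
  have bound : ∀ α β γ : ℝ, α ≤ γ → -α ≤ γ → a * α + β ≤ γ → b * α + β ≤ γ →
      c * α - β ≤ γ → m * α + n * β ≤ γ := by
    intro α β γ h1 h2 h3 h4 h5
    have := convexHull_le (φ := α • x + β • y) (c := γ) ?_ hv
    · simp [hxf, hxg, hyf, hyg] at this
      linarith
    · rintro w (rfl | rfl | rfl | rfl | rfl) <;> simp [hxf, hxg, hyf, hyg] <;> linarith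
  have hn1 : (n : ℝ) ≤ 1 := by simpa using bound 0 1 1
  have hn2 : -(n : ℝ) ≤ 1 := by simpa using bound 0 (-1) 1
  have hn1' : n ≤ 1 := by exact_mod_cast hn1
  have hn2' : -1 ≤ n := by
    have : (-1 : ℝ) ≤ n := by linarith
    exact_mod_cast this
  have ca := abs_nonneg (a : ℝ)
  have cc := abs_nonneg (c : ℝ)
  have ca1 := neg_abs_le (a : ℝ)
  have ca2 := le_abs_self (a : ℝ)
  have cc1 := neg_abs_le (c : ℝ)
  have cc2 := le_abs_self (c : ℝ)
  -- `K` makes the functionals below so steep that their maximum `K` is attained on the row of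
  -- height `n`, at its right or left end. This confines `m` to that row even when `±f` are not
  -- vertices.
  set K : ℝ := |(a : ℝ)| + |(c : ℝ)| + 2 with hK
  obtain rfl | rfl | rfl : n = -1 ∨ n = 0 ∨ n = 1 := by omega
  · have h1 := bound 1 (c - K) K
    have h2 := bound (-1) (-c - K) K
    have hm : m = c := by
      apply le_antisymm
      · have : (m : ℝ) ≤ c := by
          push_cast at h1
          linarith [h1 (by linarith) (by linarith) (by linarith) (by linarith) (by linarith)]
        exact_mod_cast this
      · have : (c : ℝ) ≤ m := by
          push_cast at h2
          linarith [h2 (by linarith) (by linarith) (by linarith) (by linarith) (by linarith)]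
        exact_mod_cast this
    subst hm
    simp [ruledVertices, sub_eq_add_neg]
  · rcases hp.natAbs_eq_one h.left_mem (m := m) (by simp) with rfl | rfl <;> simp [ruledVertices]
  · have h1 := bound 1 (K - b) K
    have h2 := bound (-1) (K + a) K
    have hm1 : m ≤ b := by
      have : (m : ℝ) ≤ b := by
        push_cast at h1
        linarith [h1 (by linarith) (by linarith) (by linarith) (by linarith) (by linarith)]
      exact_mod_cast this
    have hm2 : a ≤ m := by
      have : (a : ℝ) ≤ m := by
        push_cast at h2
        linarith [h2 (by linarith) (by linarith) (by linarith) (by linarith) (by linarith)]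
      exact_mod_cast this
    have : m = a ∨ m = b := by omega
    rcases this with rfl | rfl <;> simp [ruledVertices]

theorem primPoints_convexHull_ruledVertices (h : IsLatticeBasis N f g) (a c : ℤ) :
    primPoints N (convexHull ℝ (ruledVertices f g a c)) = ruledVertices f g a c := by
  have := h.primPoints_convexHull_insert a c (b := a) (Or.inl rfl)
  rwa [Set.insert_eq_of_mem (by simp [ruledVertices])] at this

theorem ncard_insert_ruledVertices (h : IsLatticeBasis N f g) (a c : ℤ) :
    (insert (((a + 1 : ℤ) : ℝ) • f + g) (ruledVertices f g a c)).ncard = 5 := by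
  rw [Set.ncard_insert_of_notMem _ (finite_ruledVertices f g a c), h.ncard_ruledVertices]
  rintro (e | e | e | e)
  · have := (h.inj (y := 1) (x' := 1) (y' := 0) (by simpa using e)).2
    norm_num at this
  · have := (h.inj (y := 1) (x' := -1) (y' := 0) (by simpa using e)).2
    norm_num at this
  · have := (h.inj (y := 1) (y' := 1) (by simpa using e)).1
    linarith
  · have := (h.inj (y := 1) (x' := c) (y' := -1)
      (by simpa [← sub_eq_add_neg] using show _ = _ from e)).2
    norm_num at this

theorem insert_ruledVertices (f g : V) (a c : ℤ) :
    insert (((a + 1 : ℤ) : ℝ) • f + g) (ruledVertices f g a c) =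
      insert ((a : ℝ) • f + g) (ruledVertices f g (a + 1) c) := by
  unfold ruledVertices
  ext v
  simp only [Set.mem_insert_iff]
  tauto

variable [FiniteDimensional ℝ V]

theorem isFanoPolytope_of_subset (h : IsLatticeBasis N f g) {a c : ℤ} {B : Set V}
    (hfin : B.Finite) (hB : ∀ v ∈ B, IsPrimitive N v) (hsub : ruledVertices f g a c ⊆ B) :
    IsFanoPolytope N ⊤ (convexHull ℝ B) := by
  refine isFanoPolytope_convexHull hfin hB (fun _ _ => trivial) ?_
  rw [Submodule.top_coe, nhdsWithin_univ]
  have hm : ∀ v ∈ ruledVertices f g a c, v ∈ convexHull ℝ B :=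
    fun v hv => subset_convexHull ℝ _ (hsub hv)
  refine h.mem_nhds_of_pair (convex_convexHull ℝ _) (hm _ ?_) (hm _ ?_) one_pos
    (neg_one_lt_zero) (s := a) (s' := c) (hm _ ?_) (hm _ ?_) <;>
    simp [ruledVertices, sub_eq_add_neg]

theorem isFanoPolytope_ruledVertices (h : IsLatticeBasis N f g) (a c : ℤ) :
    IsFanoPolytope N ⊤ (convexHull ℝ (ruledVertices f g a c)) :=
  h.isFanoPolytope_of_subset (finite_ruledVertices f g a c)
    (h.isPrimitive_ruledVertices a c) subset_rfl

variable [DiscreteTopology N]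

/-- The Mori fiber polygon with fiber spanned by `±f` and sections at heights `±1`. -/
def ruled (h : IsLatticeBasis N f g) (a c : ℤ) : MoriFiberPolytope N where
  total := convexHull ℝ (ruledVertices f g a c)
  fiber := convexHull ℝ {f, -f}
  isMori := h.isFanoMoriFiberStructure (h.isFanoPolytope_ruledVertices a c)
    (h.primPoints_convexHull_ruledVertices a c)

end IsLatticeBasis

/-- Two Mori fiber polygons are connected by a finite sequence of elementary links. -/
def Linked (N : Submodule ℤ V) : MoriFiberPolytope N → MoriFiberPolytope N → Prop :=
  Relation.ReflTransGen (IsElementaryLink N)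

theorem Linked.symm {X Y : MoriFiberPolytope N} (h : Linked N X Y) : Linked N Y X :=
  haveI : Std.Symm (IsElementaryLink N) := ⟨fun _ _ => Or.symm⟩
  Std.Symm.symm (r := Relation.ReflTransGen (IsElementaryLink N)) _ _ h

theorem Linked.trans {X Y Z : MoriFiberPolytope N} (h : Linked N X Y) (h' : Linked N Y Z) :
    Linked N X Z :=
  Relation.ReflTransGen.trans h h'

theorem IsLinkDiagram.linked {X Y : MoriFiberPolytope N} (h : IsLinkDiagram N X Y) :
    Linked N X Y :=
  Relation.ReflTransGen.single (Or.inl h)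

/-! ### The elementary links. -/

namespace IsLatticeBasis

variable [FiniteDimensional ℝ V] [DiscreteTopology N]

/-- Adding both sections `a` and `a + 1` gives a polygon with five primitive points; dropping either
one is a reduction that keeps the fiber. The sections must be adjacent so that no lattice point
appears between them. This is an elementary transformation of Hirzebruch surfaces. -/
theorem linked_add_one (h : IsLatticeBasis N f g) (a c : ℤ) :
    Linked N (h.ruled a c) (h.ruled (a + 1) c) := by
  set B := insert (((a + 1 : ℤ) : ℝ) • f + g) (ruledVertices f g a c) with hB
  have hprim : primPoints N (convexHull ℝ B) = B :=
    h.primPoints_convexHull_insert a c (Or.inr rfl)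
  have hsub1 : ruledVertices f g a c ⊆ B := Set.subset_insert _ _
  have hsub2 : ruledVertices f g (a + 1) c ⊆ B := by
    rw [hB, insert_ruledVertices]
    exact Set.subset_insert _ _
  have hfano : IsFanoPolytope N ⊤ (convexHull ℝ B) :=
    h.isFanoPolytope_of_subset ((finite_ruledVertices f g a c).insert _)
      (fun v hv => by rw [← hprim] at hv; exact hv.2) hsub1
  refine IsLinkDiagram.linked (.typeIIni (convexHull ℝ B) (convexHull ℝ {f, -f})
    (h.isFanoFiberStructure hfano ?_ ?_)
    (hfano.reduction (h.ruled a c).isMori.total ?_ ?_)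
    (hfano.reduction (h.ruled (a + 1) c).isMori.total ?_ ?_) rfl rfl)
  · rw [hprim]; exact hsub1 (by simp [ruledVertices])
  · rw [hprim]; exact hsub1 (by simp [ruledVertices])
  all_goals
    rw [hprim]
    dsimp only [ruled]
    rw [h.primPoints_convexHull_ruledVertices]
  · exact hsub1
  · rw [h.ncard_insert_ruledVertices, h.ncard_ruledVertices]
  · exact hsub2
  · rw [h.ncard_insert_ruledVertices, h.ncard_ruledVertices]

theorem linked_left (h : IsLatticeBasis N f g) (a c : ℤ) :
    Linked N (h.ruled a c) (h.ruled 0 c) := by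
  induction a using Int.induction_on with
  | zero => exact Relation.ReflTransGen.refl
  | succ n ih => exact (h.linked_add_one n c).symm.trans ih
  | pred n ih =>
    have := h.linked_add_one (-n - 1) c
    rw [sub_add_cancel] at this
    exact this.trans ih

/-- Turning `g` around exchanges the two sections, so moving the upper section is enough to move the
lower one as well. -/
theorem ruled_neg_right (h : IsLatticeBasis N f g) (a c : ℤ) :
    h.neg_right.ruled c a = h.ruled a c := by
  refine MoriFiberPolytope.eq_of_total_of_fiber (congrArg (convexHull ℝ) ?_) rfl
  ext v
  simp only [ruledVertices, sub_neg_eq_add, ← sub_eq_add_neg, Set.mem_insert_iff,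
    Set.mem_singleton_iff]
  tauto

theorem linked_zero (h : IsLatticeBasis N f g) (a c : ℤ) :
    Linked N (h.ruled a c) (h.ruled 0 0) := by
  refine (h.linked_left a c).trans ?_
  have := h.neg_right.linked_left c 0
  rwa [ruled_neg_right, ruled_neg_right] at this

/-- The sections `±(k f + g)` of the sheared product are sections over the same fiber, with
parameters `k` and `-k` in the original basis. -/
theorem linked_shear (h : IsLatticeBasis N f g) (k : ℤ) :
    Linked N ((h.shear k).ruled 0 0) (h.ruled 0 0) := by
  have : (h.shear k).ruled 0 0 = h.ruled k (-k) := by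
    refine MoriFiberPolytope.eq_of_total_of_fiber (congrArg (convexHull ℝ) ?_) rfl
    simp [ruledVertices, sub_eq_add_neg, add_comm]
  rw [this]
  exact h.linked_zero k (-k)

theorem ruled_neg_left (h : IsLatticeBasis N f g) (a c : ℤ) :
    h.neg_left.ruled a c = h.ruled (-a) (-c) := by
  refine MoriFiberPolytope.eq_of_total_of_fiber (congrArg (convexHull ℝ) ?_)
    (congrArg (convexHull ℝ) ?_)
  · simp only [ruledVertices, neg_neg, smul_neg, Int.cast_neg, neg_smul]
    exact Set.insert_comm _ _ _
  · rw [neg_neg]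
    exact Set.pair_comm _ _

theorem ruled_total_isFiberStructure (h : IsLatticeBasis N f g) (a c : ℤ) :
    IsFanoFiberStructure N ⊤ (h.ruled a c).total (h.ruled a c).total := by
  apply (h.ruled a c).isMori.total.isFanoFiberStructure_self
  dsimp only [ruled]
  rw [h.primPoints_convexHull_ruledVertices]
  exact ⟨f, by simp [ruledVertices]⟩

/-- The polygon with points `±f, ±g` carries both rulings; the middle fiber of the type IV_m link is
the whole polygon. -/
theorem linked_swap (h : IsLatticeBasis N f g) :
    Linked N (h.ruled 0 0) (h.swap.ruled 0 0) := by
  have e : (h.ruled 0 0).total = (h.swap.ruled 0 0).total := by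
    refine congrArg (convexHull ℝ) ?_
    ext v
    simp only [ruledVertices, Int.cast_zero, zero_smul, zero_add, zero_sub, Set.mem_insert_iff,
      Set.mem_singleton_iff]
    tauto
  have hspan := (h.ruled 0 0).isMori.total.span_eq
  refine IsLinkDiagram.linked (.typeIVm (h.ruled 0 0).total
    (h.ruled_total_isFiberStructure 0 0) e ?_ ?_)
  · rw [hspan]; exact (h.ruled 0 0).isMori
  · rw [hspan, e]; exact (h.swap.ruled 0 0).isMori

/-- The end of the Euclidean algorithm. Since `g₀` is an integral combination of `f` and `g`, the
height of `g` is a unit, so the two bases differ by signs and a shear. -/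
theorem linked_of_height_zero {f₀ g₀ : V} (h₀ : IsLatticeBasis N f₀ g₀)
    (h : IsLatticeBasis N f g) (hf : f = f₀ ∨ f = -f₀) :
    Linked N (h.ruled 0 0) (h₀.ruled 0 0) := by
  wlog hf' : f = f₀ generalizing f
  · have h1 := hf.resolve_left hf'
    have := this h.neg_left (Or.inl (by rw [h1, neg_neg])) (by rw [h1, neg_neg])
    rwa [ruled_neg_left, neg_zero] at this
  subst hf'
  obtain ⟨m, n, rfl⟩ := h₀.exists_int g h.right_mem
  obtain ⟨k, l, hkl⟩ := h.exists_int g₀ h₀.right_mem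
  have := (h₀.inj (x := 0) (y := 1) (x' := k + l * m) (y' := l * n) (by
    rw [zero_smul, zero_add, one_smul]
    conv_lhs => rw [hkl]
    module)).2
  have hln : l * n = 1 := by exact_mod_cast this.symm
  rcases Int.isUnit_iff.1 (IsUnit.of_mul_eq_one_right _ hln) with rfl | rfl
  · have e : ((m : ℝ) • f + ((1 : ℤ) : ℝ) • g₀) = (m : ℝ) • f + g₀ := by simp
    convert h₀.linked_shear m using 1
    exact MoriFiberPolytope.eq_of_total_of_fiber (by simp only [ruled, e]) rfl
  · have e : ((m : ℝ) • f + ((-1 : ℤ) : ℝ) • g₀) = (m : ℝ) • f + -g₀ := by simp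
    have := h₀.neg_right.linked_shear m
    rw [h₀.ruled_neg_right] at this
    convert this using 1
    exact MoriFiberPolytope.eq_of_total_of_fiber (by simp only [ruled, e]) rfl

/-- The Euclidean algorithm connects the product polygons of any two lattice bases. -/
theorem linked_basis {f₀ g₀ : V} (h₀ : IsLatticeBasis N f₀ g₀) (k : ℕ) :
    ∀ {f g : V} (h : IsLatticeBasis N f g) (m n : ℤ), n.natAbs = k →
      f = (m : ℝ) • f₀ + (n : ℝ) • g₀ → Linked N (h.ruled 0 0) (h₀.ruled 0 0) := by
  induction k using Nat.strong_induction_on with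
  | _ k ih =>
  intro f g h m n hk hf
  rcases eq_or_ne n 0 with rfl | hn
  · rw [Int.cast_zero, zero_smul, add_zero] at hf
    apply h₀.linked_of_height_zero h
    rcases h.isPrimitive_left.natAbs_eq_one h₀.left_mem hf with rfl | rfl
    · left; simpa using hf
    · right; simpa using hf
  · obtain ⟨p, q, hg⟩ := h₀.exists_int g h.right_mem
    -- Division with remainder: the shear changes the second coordinate `q` of `g` into `q % n`, and
    -- the swap makes this vector the new fiber direction, of smaller height than `n`.
    have h' := (h.shear (-(q / n))).swap
    refine ((h.linked_shear (-(q / n))).symm.trans (h.shear (-(q / n))).linked_swap).trans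
      (ih (q % n).natAbs ?_ h' (p - q / n * m) (q % n) rfl ?_)
    · rw [← hk]
      have h1 := Int.emod_nonneg q hn
      have h2 := Int.emod_lt_abs q hn
      rw [Int.abs_eq_natAbs] at h2
      omega
    · have : ((q % n : ℤ) : ℝ) = q - n * (q / n : ℤ) := by
        exact_mod_cast Int.emod_def q n
      rw [this, hf, hg]
      push_cast
      module

theorem linked_product {f₀ g₀ : V} (h₀ : IsLatticeBasis N f₀ g₀) (h : IsLatticeBasis N f g)
    (a c : ℤ) : Linked N (h.ruled a c) (h₀.ruled 0 0) := by
  obtain ⟨m, n, hf⟩ := h₀.exists_int f h.left_mem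
  exact (h.linked_zero a c).trans (h₀.linked_basis _ h m n rfl hf)

/-- The polygon of the projective plane is linked to the polygon of its blow-up. -/
theorem linked_triangle (h : IsLatticeBasis N u v)
    (X : MoriFiberPolytope N) (hX : primPoints N X.total = {u, v, -u - v})
    (hcard : (primPoints N X.total).ncard = 3) (hfib : X.fiber = X.total) :
    Linked N (h.neg_left.ruled 0 1) X := by
  -- Over the basis `-u, v` the parameters `0, 1` give the points `-u, u, v, -u - v`: the triangle
  -- with the single extra point `-u`.
  set Y := h.neg_left.ruled 0 1 with hY
  have hspan := Y.isMori.total.span_eq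
  have hprim : primPoints N Y.total = ruledVertices (-u) v 0 1 :=
    h.neg_left.primPoints_convexHull_ruledVertices 0 1
  have hred : IsFanoReduction N ⊤ Y.total X.total := by
    apply Y.isMori.total.reduction X.isMori.total
    · rw [hX, hprim]
      rintro w (rfl | rfl | rfl) <;> simp [ruledVertices]
    · rw [hcard, hprim, h.neg_left.ncard_ruledVertices]
  -- The middle fiber is the whole polygon `Y`, so the same reduction serves for the polygons and
  -- for the fibers.
  refine IsLinkDiagram.linked (.typeIm Y.total
    (h.neg_left.ruled_total_isFiberStructure 0 1) hred ?_ ?_)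
  · rw [hspan]; exact Y.isMori
  · rw [hspan, hfib]; exact hred

theorem linked_all {f₀ g₀ : V} (h₀ : IsLatticeBasis N f₀ g₀) (hdim : Module.finrank ℝ V = 2)
    (X : MoriFiberPolytope N) : Linked N X (h₀.ruled 0 0) := by
  rcases X.classification h₀ hdim with ⟨hcard, hfib⟩ | ⟨p, q, hpq, hfib, a, c, htot⟩
  · obtain ⟨u, v, huv, hA⟩ := h₀.exists_eq_triangle hdim X.isMori.total hcard
    exact (huv.linked_triangle X hA hcard hfib).symm.trans
      (h₀.linked_product huv.neg_left 0 1)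
  · have : X = hpq.ruled a c := MoriFiberPolytope.eq_of_total_of_fiber htot hfib
    rw [this]
    exact h₀.linked_product hpq a c

end IsLatticeBasis

end Links

end FanoLinks

theorem proposition3p5 {V : Type*} [NormedAddCommGroup V] [NormedSpace ℝ V]
    (N : Submodule ℤ V) [DiscreteTopology N] [IsZLattice ℝ N]
    (hdim : Module.finrank ℝ V = 2) :
    (∀ P : Set V, FanoLinks.IsMinimalFano N ⊤ P →
      ∃ F : Set V, FanoLinks.IsFanoMoriFiberStructure N ⊤ P F) ∧
    (∀ X Y : FanoLinks.MoriFiberPolytope N,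
      Relation.ReflTransGen (FanoLinks.IsElementaryLink N) X Y) := by
  have : FiniteDimensional ℝ V := Module.finite_of_finrank_pos (by omega)
  obtain ⟨f, g, h⟩ := FanoLinks.exists_isLatticeBasis N hdim
  exact ⟨fun P hP => hP.exists_isFanoMoriFiberStructure h hdim,
    fun X Y => (h.linked_all hdim X).trans (h.linked_all hdim Y).symm⟩
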